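/- **Conventions.** Sets are small; categories are locally small and may have a large set of objects. $\mathbf{FL}(\mathbb A,\mathbb B)$ denotes the finite-limit-preserving functors $\mathbb A\to\mathbb B$. A 2-functor is an *equivalence on hom-categories* if each functor it induces between hom-categories is an equivalence; its *biessential image* consists of the objects equivalent to one in its image. A *biequivalence* is a homomorphism of bicategories having a pseudo-inverse, that is, a homomorphism in the other direction such that both composites are equivalent to the identity in the bicategory of homomorphisms, pseudonatural transformations and modifications. **Lex profunctors.** The bicategory $\mathbf{LexProf}$ has as objects the small categories with finite limits; a 1-cell $\mathbb A\to\mathbb B$ is a functor $M\colon\mathbb A^{\mathrm{op}}\times\mathbb B\to\mathbf{Set}$ preserving finite limits in its second variable; 2-cells are natural transformations; the identity is $I_{\mathbb A}(a',a)=\mathbb A(a',a)$, and composition is $(N\otimes M)(a,c)=\int^{b}N(b,c)\times M(a,b)$. **$\mathbf{LexProf}$-categories.** For a bicategory $\mathcal W$, a $\mathcal W$-category $\mathcal C$ has a set of objects, each with an extent in $\mathcal W$ (write $\mathcal C_x$ for the objects of extent $x$), hom-objects $\mathcal C(X,Y)\in\mathcal W(x,y)$ for $X\in\mathcal C_x$,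 $Y\in\mathcal C_y$, and composition maps $\mathcal C(Y,Z)\otimes\mathcal C(X,Y)\to\mathcal C(X,Z)$ and identities $I_x\to\mathcal C(X,X)$ satisfying the associativity and unit laws. A $\mathcal W$-functor is an extent-preserving map on objects with maps $\mathcal C(X,Y)\to\mathcal D(FX,FY)$ respecting composition and identities. A $\mathcal W$-transformation $F\Rightarrow G$ is a family $I_x\to\mathcal D(FX,GX)$ satisfying $\mathcal W$-naturality. These form the 2-category $\mathcal W\text{-}\mathbf{CAT}$; we take $\mathcal W=\mathbf{LexProf}$. **Absolute tensors.** A *tensor* of $X\in\mathcal C_x$ by $W\in\mathcal W(x,y)$ is an object $Y\in\mathcal C_y$ with a map $u\colon W\to\mathcal C(X,Y)$ such that, for all $z$, $U\in\mathcal W(y,z)$ and $Z\in\mathcal C_z$, sending $f\colon U\to\mathcal C(Y,Z)$ to $U\otimes W\xrightarrow{f\otimes u}\mathcal C(Y,Z)\otimes\mathcal C(X,Y)\to\mathcal C(X,Z)$ is a bijection onto the maps $U\otimes W\to\mathcal C(X,Z)$. A $\mathcal W$-functor $F$ preserves it if $F_{X,Y}\circ u$ exhibits $FY$ as a tensor of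 $FX$ by $W$. Tensors by $W$ are *absolute* if they are preserved by every $\mathcal W$-functor. A $\mathcal W$-category is *absolute-tensored* if it has all tensors by those $W$ for which tensors by $W$ are absolute. **Partially finitely complete categories.** A *left-exact sieve* $\mathcal S$ on a category $\mathcal C$ is a collection of finite-limit-preserving functors $\mathbb A\to\mathcal C$ with small finitely complete domains such that: (i) if $X\colon\mathbb B\to\mathcal C$ is in $\mathcal S$ and $G\in\mathbf{FL}(\mathbb A,\mathbb B)$, then $XG\in\mathcal S$; (ii) $\mathcal S$ is closed under isomorphism of functors; (iii) each object of $\mathcal C$ is in the image of some functor in $\mathcal S$. A *partially finitely complete category* is a category with a left-exact sieve. $\mathbf{PARFL}$ is the 2-category of these, of functors $F$ such that $FX\in\mathcal S_{\mathcal D}$ for all $X\in\mathcal S_{\mathcal C}$, and of all natural transformations. **The 2-functor $\Gamma$.** $\Gamma\colon\mathbf{PARFL}\to\mathbf{LexProf}\text{-}\mathbf{CAT}$ sends $\mathcal C$ to the $\mathbf{LexProf}$-category whose objects of extent $\mathbb A$ are the $X\colon\mathbb A\to\mathcal C$ in $\mathcal S_{\mathcal C}$, with $\Gamma(\mathcal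 C)(X,Y)(i,j)=\mathcal C(Xi,Yj)$, composition that of $\mathcal C$, and identities $\mathbb A(i,j)\to\mathcal C(Xi,Xj)$ the action of $X$ on maps. $\Gamma(F)$ is $X\mapsto FX$ on objects and acts as $F$ on homs; $\Gamma(\alpha)$ has components at $X$ given by the elements $\alpha_{Xi}$. **The 2-functor $\int$.** $\int\colon\mathbf{LexProf}\text{-}\mathbf{CAT}\to\mathbf{PARFL}$ sends $\mathcal C$ to the category with objects $(X,i)$, where $X\in\mathcal C_{\mathbb A}$ and $i\in\mathbb A$, and maps $(X,i)\to(Y,j)$ the elements of $\mathcal C(X,Y)(i,j)$, with composition and identities from $\mathcal C$. For $X\in\mathcal C_{\mathbb A}$ let $\iota_X\colon\mathbb A\to\int\mathcal C$ be $i\mapsto(X,i)$, acting on maps by $\mathbb A(i,i')\to\mathcal C(X,X)(i,i')$. The sieve of $\int\mathcal C$ consists of the functors isomorphic to some $\iota_YF$ with $Y\in\mathcal C_{\mathbb B}$ and $F\in\mathbf{FL}(\mathbb A,\mathbb B)$. On 1-cells, $\int F$ sends $(X,i)$ to $(FX,i)$ and acts as $F$ on maps; on 2-cells, $\int\alpha$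 has component at $(X,i)$ the value of $\alpha_X\colon I_{\mathbb A}\to\mathcal D(FX,GX)$ at $1_i$. Let $\eta_{\mathcal C}\colon\mathcal C\to\Gamma(\int\mathcal C)$ be the $\mathbf{LexProf}$-functor $X\mapsto\iota_X$ that is the identity on homs. **Theorem.** 1. $\Gamma$ is an equivalence on hom-categories. 2. The biessential image of $\Gamma$ consists of exactly the absolute-tensored $\mathbf{LexProf}$-categories. 3. Thus $\Gamma$ takes values in the full and locally full sub-2-category of $\mathbf{LexProf}\text{-}\mathbf{CAT}$ on the absolute-tensored $\mathbf{LexProf}$-categories, and is a biequivalence from $\mathbf{PARFL}$ to it. 4. $\int$ is left 2-adjoint to $\Gamma$ with unit $\eta$: the maps $\eta_{\mathcal C}$ are 2-natural in $\mathcal C$, and for each $\mathbf{LexProf}$-category $\mathcal C$ and each $\mathcal D\in\mathbf{PARFL}$ the functor $\mathbf{PARFL}(\int\mathcal C,\mathcal D)\to\mathbf{LexProf}\text{-}\mathbf{CAT}(\mathcal C,\Gamma\mathcal D)$, $F\mapsto\Gamma(F)\circ\eta_{\mathcal C}$, is an isomorphism of categories. 5. $\eta_{\mathcal C}\colon\mathcal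 C\to\Gamma(\int\mathcal C)$ is the free completion of $\mathcal C$ under absolute tensors: $\Gamma(\int\mathcal C)$ is absolute-tensored, and for each absolute-tensored $\mathcal D$, restriction along $\eta_{\mathcal C}$ is an equivalence of categories $\mathbf{LexProf}\text{-}\mathbf{CAT}(\Gamma(\int\mathcal C),\mathcal D)\to\mathbf{LexProf}\text{-}\mathbf{CAT}(\mathcal C,\mathcal D)$. -/

import Mathlib

set_option linter.unusedVariables false
set_option linter.unusedSimpArgs false
attribute [-instance] CategoryTheory.catToReflQuiver

open CategoryTheory Bicategory Opposite Limits

universe w v u o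

/-! ## Categories enriched in a bicategory -/

/-- A category enriched in a bicategory `W`. The set of objects with its extent function is given
as the family of its fibres: `Obj x` is the set of objects of extent `x`. Composition in `W` is
written in diagrammatic order, so that `hom X Y ≫ hom Y Z` is `hom Y Z ⊗ hom X Y`. -/
structure WCategory (W : Type u) [Bicategory.{w, v} W] where
  /-- The objects of a given extent. -/
  Obj : W → Type o
  /-- The hom-objects. -/
  hom : ∀ {x y : W}, Obj x → Obj y → (x ⟶ y)
  /-- The composition maps. -/
  comp : ∀ {x y z : W} (X : Obj x) (Y : Obj y) (Z : Obj z), hom X Y ≫ hom Y Z ⟶ hom X Z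
  /-- The identities maps. -/
  ident : ∀ {x : W} (X : Obj x), 𝟙 x ⟶ hom X X
  ident_comp : ∀ {x y : W} (X : Obj x) (Y : Obj y),
    ident X ▷ hom X Y ≫ comp X X Y = (λ_ (hom X Y)).hom
  comp_ident : ∀ {x y : W} (X : Obj x) (Y : Obj y),
    hom X Y ◁ ident Y ≫ comp X Y Y = (ρ_ (hom X Y)).hom
  comp_assoc : ∀ {x y z t : W} (X : Obj x) (Y : Obj y) (Z : Obj z) (T : Obj t),
    comp X Y Z ▷ hom Z T ≫ comp X Z T =
      (α_ (hom X Y) (hom Y Z) (hom Z T)).hom ≫ hom X Y ◁ comp Y Z T ≫ comp X Y T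

section Enriched

variable {W : Type u} [Bicategory.{w, v} W]

namespace WCategory

/-- For `f : U ⟶ C(X, Y)` and `g : V ⟶ C(Y, Z)`, the composite
`V ⊗ U ⟶ C(Y, Z) ⊗ C(X, Y) ⟶ C(X, Z)` of `g ⊗ f` with composition in `C`. -/
def mul (C : WCategory.{w, v, u, o} W) {x y z : W} {X : C.Obj x} {Y : C.Obj y} {Z : C.Obj z}
    {U : x ⟶ y} {V : y ⟶ z} (f : U ⟶ C.hom X Y) (g : V ⟶ C.hom Y Z) : U ≫ V ⟶ C.hom X Z :=
  f ▷ V ≫ C.hom X Y ◁ g ≫ C.comp X Y Z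

variable (C : WCategory.{w, v, u, o} W) {x y z t : W} {X : C.Obj x} {Y : C.Obj y} {Z : C.Obj z}
  {T : C.Obj t}

theorem whiskerRight_mul {U U' : x ⟶ y} {V : y ⟶ z} (h : U' ⟶ U)
    (f : U ⟶ C.hom X Y) (g : V ⟶ C.hom Y Z) : h ▷ V ≫ C.mul f g = C.mul (h ≫ f) g := by
  simp [mul]

theorem whiskerLeft_mul {U : x ⟶ y} {V V' : y ⟶ z} (h : V' ⟶ V)
    (f : U ⟶ C.hom X Y) (g : V ⟶ C.hom Y Z) : U ◁ h ≫ C.mul f g = C.mul f (h ≫ g) := by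
  simp [mul, whisker_exchange_assoc]

theorem ident_mul {V : x ⟶ z} (g : V ⟶ C.hom X Z) : C.mul (C.ident X) g = (λ_ V).hom ≫ g := by
  simp [mul, ← whisker_exchange_assoc, C.ident_comp]

theorem mul_ident {V : x ⟶ z} (g : V ⟶ C.hom X Z) : C.mul g (C.ident Z) = (ρ_ V).hom ≫ g := by
  simp [mul, C.comp_ident]

theorem mul_assoc {U : x ⟶ y} {V : y ⟶ z} {R : z ⟶ t}
    (f : U ⟶ C.hom X Y) (g : V ⟶ C.hom Y Z) (h : R ⟶ C.hom Z T) :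
    C.mul (C.mul f g) h = (α_ U V R).hom ≫ C.mul f (C.mul g h) := by
  simp only [mul, comp_whiskerRight, Category.assoc, whisker_assoc, whiskerLeft_comp]
  rw [← whisker_exchange_assoc, C.comp_assoc]
  simp

end WCategory

/-- A functor between categories enriched in `W`. -/
@[ext]
structure WFunctor (C D : WCategory.{w, v, u, o} W) where
  /-- The extent-preserving action on objects. -/
  obj : ∀ {x : W}, C.Obj x → D.Obj x
  /-- The action on hom-objects. -/
  map : ∀ {x y : W} (X : C.Obj x) (Y : C.Obj y), C.hom X Y ⟶ D.hom (obj X) (obj Y)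
  map_ident : ∀ {x : W} (X : C.Obj x), C.ident X ≫ map X X = D.ident (obj X)
  map_comp : ∀ {x y z : W} (X : C.Obj x) (Y : C.Obj y) (Z : C.Obj z),
    C.comp X Y Z ≫ map X Z = D.mul (map X Y) (map Y Z)

theorem WFunctor.mul_map {C D : WCategory.{w, v, u, o} W} (F : WFunctor C D) {x y z : W}
    {X : C.Obj x} {Y : C.Obj y} {Z : C.Obj z} {U : x ⟶ y} {V : y ⟶ z}
    (f : U ⟶ C.hom X Y) (g : V ⟶ C.hom Y Z) :
    C.mul f g ≫ F.map X Z = D.mul (f ≫ F.map X Y) (g ≫ F.map Y Z) := by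
  rw [← WCategory.whiskerRight_mul, ← WCategory.whiskerLeft_mul, ← F.map_comp]
  simp [WCategory.mul]

/-- A transformation between functors of categories enriched in `W`. -/
@[ext]
structure WTrans {C D : WCategory.{w, v, u, o} W} (F G : WFunctor C D) where
  /-- The components. -/
  app : ∀ {x : W} (X : C.Obj x), 𝟙 x ⟶ D.hom (F.obj X) (G.obj X)
  naturality : ∀ {x y : W} (X : C.Obj x) (Y : C.Obj y),
    (ρ_ (C.hom X Y)).inv ≫ D.mul (F.map X Y) (app Y) =
      (λ_ (C.hom X Y)).inv ≫ D.mul (app X) (G.map X Y)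

namespace WTrans

variable {C D E : WCategory.{w, v, u, o} W}

/-- The identity transformation. -/
@[simps]
def id (F : WFunctor C D) : WTrans F F where
  app X := D.ident (F.obj X)
  naturality X Y := by simp [D.ident_mul, D.mul_ident]

/-- Vertical composition of transformations. -/
@[simps]
def vcomp {F G H : WFunctor C D} (α : WTrans F G) (β : WTrans G H) : WTrans F H where
  app {x} X := (λ_ (𝟙 x)).inv ≫ D.mul (α.app X) (β.app X)
  naturality {x y} X Y := by
    have h1 : D.mul (F.map X Y) (α.app Y) =
        ((ρ_ _).hom ≫ (λ_ _).inv) ≫ D.mul (α.app X) (G.map X Y) := by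
      rw [Category.assoc, ← α.naturality X Y, Iso.hom_inv_id_assoc]
    have h2 : D.mul (G.map X Y) (β.app Y) =
        ((ρ_ _).hom ≫ (λ_ _).inv) ≫ D.mul (β.app X) (H.map X Y) := by
      rw [Category.assoc, ← β.naturality X Y, Iso.hom_inv_id_assoc]
    rw [← D.whiskerLeft_mul, ← D.whiskerRight_mul, D.mul_assoc,
      (Iso.eq_inv_comp _).mpr (D.mul_assoc (F.map X Y) (α.app Y) (β.app Y)).symm, h1,
      ← D.whiskerRight_mul, D.mul_assoc, h2, ← D.whiskerLeft_mul]
    simp only [← Category.assoc]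
    congr 1
    bicategory_coherence

instance (C D : WCategory.{w, v, u, o} W) : Category (WFunctor C D) where
  Hom F G := WTrans F G
  id F := WTrans.id F
  comp α β := WTrans.vcomp α β
  id_comp {F G} α := by
    ext x X
    simp [WCategory.ident_mul]
  comp_id {F G} α := by
    ext x X
    simp [WCategory.mul_ident]
  assoc {F G H K} α β γ := by
    ext x X
    simp only [vcomp_app]
    rw [← WCategory.whiskerLeft_mul, ← WCategory.whiskerRight_mul, WCategory.mul_assoc]
    simp

theorem id_app' (F : WFunctor C D) {x : W} (X : C.Obj x) :
    WTrans.app (𝟙 F) X = D.ident (F.obj X) := rfl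

theorem comp_app' {F G H : WFunctor C D} (α : F ⟶ G) (β : G ⟶ H) {x : W} (X : C.Obj x) :
    WTrans.app (α ≫ β) X = (λ_ (𝟙 x)).inv ≫ D.mul (WTrans.app α X) (WTrans.app β X) := rfl

@[ext]
theorem ext' {F G : WFunctor C D} {α β : F ⟶ G}
    (h : ∀ {x : W} (X : C.Obj x), WTrans.app α X = WTrans.app β X) : α = β :=
  WTrans.ext (by funext x X; exact h X)

end WTrans

namespace WFunctor

variable {C D E : WCategory.{w, v, u, o} W}

/-- The identity functor. -/
abbrev id (C : WCategory.{w, v, u, o} W) : WFunctor C C where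
  obj X := X
  map X Y := 𝟙 _
  map_ident X := by simp
  map_comp X Y Z := by simp [WCategory.mul]

/-- Composition of functors. -/
abbrev comp (F : WFunctor C D) (G : WFunctor D E) : WFunctor C E where
  obj X := G.obj (F.obj X)
  map X Y := F.map X Y ≫ G.map _ _
  map_ident X := by rw [← Category.assoc, F.map_ident, G.map_ident]
  map_comp X Y Z := by rw [← Category.assoc, F.map_comp, G.mul_map]

end WFunctor

namespace WTrans

variable {C D E : WCategory.{w, v, u, o} W}

/-- Left whiskering of a transformation. -/
@[simps]
def whiskerLeft (F : WFunctor C D) {G H : WFunctor D E} (α : WTrans G H) :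
    WTrans (F.comp G) (F.comp H) where
  app X := α.app (F.obj X)
  naturality {x y} X Y := by
    have h := F.map X Y ≫= α.naturality (F.obj X) (F.obj Y)
    change (ρ_ _).inv ≫ E.mul (F.map X Y ≫ G.map _ _) (α.app (F.obj Y)) =
      (λ_ _).inv ≫ E.mul (α.app (F.obj X)) (F.map X Y ≫ H.map _ _)
    rw [← E.whiskerRight_mul, ← E.whiskerLeft_mul]
    simpa using h

/-- Right whiskering of a transformation. -/
@[simps]
def whiskerRight {F G : WFunctor C D} (α : WTrans F G) (H : WFunctor D E) :
    WTrans (F.comp H) (G.comp H) where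
  app X := α.app X ≫ H.map _ _
  naturality {x y} X Y := by
    have h := α.naturality X Y =≫ H.map _ _
    simp only [Category.assoc, H.mul_map] at h
    exact h

end WTrans

/-- The 2-category of categories enriched in `W`. -/
instance : Bicategory (WCategory.{w, v, u, o} W) where
  Hom C D := WFunctor C D
  id C := WFunctor.id C
  comp F G := WFunctor.comp F G
  homCategory C D := inferInstanceAs (Category (WFunctor C D))
  whiskerLeft F _ _ α := WTrans.whiskerLeft F α
  whiskerRight α H := WTrans.whiskerRight α H
  associator {_ _ _ K} F G H :=
    { hom := 
       { app := fun X => K.ident (H.obj (G.obj (F.obj X)))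
         naturality := fun X Y => by simp [WCategory.mul_ident, WCategory.ident_mul] }
      inv := 
       { app := fun X => K.ident (H.obj (G.obj (F.obj X)))
         naturality := fun X Y => by simp [WCategory.mul_ident, WCategory.ident_mul] } 
      hom_inv_id := by
        apply WTrans.ext'
        intro x X
        simp [WTrans.comp_app', WTrans.id_app', WCategory.ident_mul]
      inv_hom_id := by
        apply WTrans.ext'
        intro x X
        simp [WTrans.comp_app', WTrans.id_app', WCategory.ident_mul] }
  leftUnitor {_ K} F :=
    { hom := 
       { app := fun X => K.ident (F.obj X)
         naturality := fun X Y => by simp [WCategory.mul_ident, WCategory.ident_mul] }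
      inv := 
       { app := fun X => K.ident (F.obj X)
         naturality := fun X Y => by simp [WCategory.mul_ident, WCategory.ident_mul] } 
      hom_inv_id := by
        apply WTrans.ext'
        intro x X
        simp [WTrans.comp_app', WTrans.id_app', WCategory.ident_mul]
      inv_hom_id := by
        apply WTrans.ext'
        intro x X
        simp [WTrans.comp_app', WTrans.id_app', WCategory.ident_mul] }
  rightUnitor {_ K} F :=
    { hom := 
       { app := fun X => K.ident (F.obj X)
         naturality := fun X Y => by simp [WCategory.mul_ident, WCategory.ident_mul] }
      inv := 
       { app := fun X => K.ident (F.obj X)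
         naturality := fun X Y => by simp [WCategory.mul_ident, WCategory.ident_mul] } 
      hom_inv_id := by
        apply WTrans.ext'
        intro x X
        simp [WTrans.comp_app', WTrans.id_app', WCategory.ident_mul]
      inv_hom_id := by
        apply WTrans.ext'
        intro x X
        simp [WTrans.comp_app', WTrans.id_app', WCategory.ident_mul] }
  whiskerLeft_id := by
    intros
    apply WTrans.ext'
    intro x X
    simp [WTrans.comp_app', WTrans.id_app', WCategory.ident_mul, WCategory.mul_ident,
      WFunctor.mul_map, WFunctor.map_ident]
  whiskerLeft_comp := by
    intros
    apply WTrans.ext'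
    intro x X
    simp [WTrans.comp_app', WTrans.id_app', WCategory.ident_mul, WCategory.mul_ident,
      WFunctor.mul_map, WFunctor.map_ident]
  id_whiskerLeft := by
    intros
    apply WTrans.ext'
    intro x X
    simp [WTrans.comp_app', WTrans.id_app', WCategory.ident_mul, WCategory.mul_ident,
      WFunctor.mul_map, WFunctor.map_ident]
  comp_whiskerLeft := by
    intros
    apply WTrans.ext'
    intro x X
    simp [WTrans.comp_app', WTrans.id_app', WCategory.ident_mul, WCategory.mul_ident,
      WFunctor.mul_map, WFunctor.map_ident]
  id_whiskerRight := by
    intros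
    apply WTrans.ext'
    intro x X
    simp [WTrans.comp_app', WTrans.id_app', WCategory.ident_mul, WCategory.mul_ident,
      WFunctor.mul_map, WFunctor.map_ident]
  comp_whiskerRight := by
    intros
    apply WTrans.ext'
    intro x X
    simp [WTrans.comp_app', WTrans.id_app', WCategory.ident_mul, WCategory.mul_ident,
      WFunctor.mul_map, WFunctor.map_ident]
  whiskerRight_id := by
    intros
    apply WTrans.ext'
    intro x X
    simp [WTrans.comp_app', WTrans.id_app', WCategory.ident_mul, WCategory.mul_ident,
      WFunctor.mul_map, WFunctor.map_ident]
  whiskerRight_comp := by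
    intros
    apply WTrans.ext'
    intro x X
    simp [WTrans.comp_app', WTrans.id_app', WCategory.ident_mul, WCategory.mul_ident,
      WFunctor.mul_map, WFunctor.map_ident]
  whisker_assoc := by
    intros
    apply WTrans.ext'
    intro x X
    simp [WTrans.comp_app', WTrans.id_app', WCategory.ident_mul, WCategory.mul_ident,
      WFunctor.mul_map, WFunctor.map_ident]
  whisker_exchange {C D E} F G H K α β := by
    apply WTrans.ext'
    intro x X
    have h := WTrans.app α X ≫= WTrans.naturality β (F.obj X) (G.obj X)
    rw [rightUnitor_inv_naturality_assoc, leftUnitor_inv_naturality_assoc, E.whiskerRight_mul,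
      E.whiskerLeft_mul, ← unitors_inv_equal] at h
    exact h.symm
  pentagon := by
    intros
    apply WTrans.ext'
    intro x X
    simp [WTrans.comp_app', WTrans.id_app', WCategory.ident_mul, WCategory.mul_ident,
      WFunctor.mul_map, WFunctor.map_ident]
  triangle := by
    intros
    apply WTrans.ext'
    intro x X
    simp [WTrans.comp_app', WTrans.id_app', WCategory.ident_mul, WCategory.mul_ident,
      WFunctor.mul_map, WFunctor.map_ident]

theorem WTrans.eqToHom_app_heq {C D : WCategory.{w, v, u, o} W} {F G : WFunctor C D} (h : F = G)
    {x : W} (X : C.Obj x) : HEq (WTrans.app (eqToHom h) X) (D.ident (F.obj X)) := by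
  subst h
  rfl

theorem WFunctor.id_comp {C D : WCategory.{w, v, u, o} W} (F : WFunctor C D) :
    (WFunctor.id C).comp F = F := by
  apply WFunctor.ext
  · rfl
  · apply heq_of_eq
    funext x y X Y
    exact Category.id_comp _

theorem WFunctor.comp_id {C D : WCategory.{w, v, u, o} W} (F : WFunctor C D) :
    F.comp (WFunctor.id D) = F := by
  apply WFunctor.ext
  · rfl
  · apply heq_of_eq
    funext x y X Y
    exact Category.comp_id _

theorem WFunctor.assoc {C D E K : WCategory.{w, v, u, o} W} (F : WFunctor C D)
    (G : WFunctor D E) (H : WFunctor E K) : (F.comp G).comp H = F.comp (G.comp H) := by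
  apply WFunctor.ext
  · rfl
  · apply heq_of_eq
    funext x y X Y
    exact Category.assoc _ _ _

instance : Bicategory.Strict (WCategory.{w, v, u, o} W) where
  id_comp F := WFunctor.id_comp F
  comp_id F := WFunctor.comp_id F
  assoc F G H := WFunctor.assoc F G H
  leftUnitor_eqToIso F := Iso.ext (WTrans.ext' fun X =>
    (eq_of_heq (WTrans.eqToHom_app_heq (WFunctor.id_comp F) X)).symm)
  rightUnitor_eqToIso F := Iso.ext (WTrans.ext' fun X =>
    (eq_of_heq (WTrans.eqToHom_app_heq (WFunctor.comp_id F) X)).symm)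
  associator_eqToIso F G H := Iso.ext (WTrans.ext' fun X =>
    (eq_of_heq (WTrans.eqToHom_app_heq (WFunctor.assoc F G H) X)).symm)

/-! ## Tensors and absolute tensors -/

namespace WCategory

/-- The map `u : A ⟶ C(X, Y)` exhibits `Y` as a tensor of `X` by the 1-cell `A`: for each 1-cell
`U` and each `Z`, composition with `u` is a bijection from maps `U ⟶ C(Y, Z)` to maps
`U ⊗ A ⟶ C(X, Z)`. -/
def IsTensor (C : WCategory.{w, v, u, o} W) {x y : W} (A : x ⟶ y) (X : C.Obj x) (Y : C.Obj y)
    (u : A ⟶ C.hom X Y) : Prop :=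
  ∀ ⦃z : W⦄ (U : y ⟶ z) (Z : C.Obj z),
    Function.Bijective fun f : U ⟶ C.hom Y Z => (C.mul u f : A ≫ U ⟶ C.hom X Z)

/-- Tensors by the 1-cell `A` are absolute if they are preserved by every functor between
`W`-categories. -/
def AbsoluteTensorsBy {x y : W} (A : x ⟶ y) : Prop :=
  ∀ (C D : WCategory.{w, v, u, o} W) (F : WFunctor C D) (X : C.Obj x) (Y : C.Obj y)
    (u : A ⟶ C.hom X Y), C.IsTensor A X Y u →
      D.IsTensor A (F.obj X) (F.obj Y) (u ≫ F.map X Y)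

/-- A `W`-category is absolute-tensored if it admits all tensors by those 1-cells, tensors by
which are absolute. -/
def IsAbsoluteTensored (C : WCategory.{w, v, u, o} W) : Prop :=
  ∀ ⦃x y : W⦄ (A : x ⟶ y), AbsoluteTensorsBy.{w, v, u, o} A →
    ∀ X : C.Obj x, ∃ (Y : C.Obj y) (u : A ⟶ C.hom X Y), C.IsTensor A X Y u

end WCategory

end Enriched

/-! ## The bicategory of lex profunctors -/

/-- The objects of the bicategory of lex profunctors: small categories with finite limits. -/
structure LexProf : Type (v + 1) where
  /-- The underlying type of objects. -/
  carrier : Type v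
  [cat : SmallCategory carrier]
  [lim : HasFiniteLimits carrier]

namespace LexProf

instance : CoeSort LexProf.{v} (Type v) := ⟨carrier⟩

attribute [instance] cat lim

/-- A profunctor from `A` to `B`: a functor `Aᵒᵖ × B ⥤ Type`, given by its values and its commuting
actions in the two variables. -/
structure Profunctor (A B : LexProf.{v}) : Type (v + 1) where
  /-- The values. -/
  obj : A → B → Type v
  /-- The contravariant action. -/
  left : ∀ {a a' : A} {b : B}, (a' ⟶ a) → obj a b → obj a' b
  /-- The covariant action. -/
  right : ∀ {a : A} {b b' : B}, (b ⟶ b') → obj a b → obj a b'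
  left_id : ∀ {a : A} {b : B} (m : obj a b), left (𝟙 a) m = m
  left_comp : ∀ {a a' a'' : A} {b : B} (f : a'' ⟶ a') (g : a' ⟶ a) (m : obj a b),
    left (f ≫ g) m = left f (left g m)
  right_id : ∀ {a : A} {b : B} (m : obj a b), right (𝟙 b) m = m
  right_comp : ∀ {a : A} {b b' b'' : B} (f : b ⟶ b') (g : b' ⟶ b'') (m : obj a b),
    right (f ≫ g) m = right g (right f m)
  left_right : ∀ {a a' : A} {b b' : B} (f : a' ⟶ a) (g : b ⟶ b') (m : obj a b),
    left f (right g m) = right g (left f m)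

attribute [simp] Profunctor.left_id Profunctor.right_id

variable {A B C D E : LexProf.{v}}

/-- The functor of the second variable obtained by fixing the first variable. -/
def Profunctor.fib (M : Profunctor A B) (a : A) : B ⥤ Type v where
  obj b := M.obj a b
  map g := ↾(M.right g)
  map_id b := by ext m; exact M.right_id m
  map_comp f g := by ext m; exact M.right_comp f g m

/-- A lex profunctor: a profunctor that preserves finite limits in its second variable. -/
structure Prof (A B : LexProf.{v}) : Type (v + 1) extends Profunctor A B where
  lex : ∀ a : A, PreservesFiniteLimits (toProfunctor.fib a)

/-- A map of lex profunctors: a natural transformation. -/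
@[ext]
structure ProfHom (M N : Prof A B) : Type v where
  /-- The components. -/
  app : ∀ {a : A} {b : B}, M.obj a b → N.obj a b
  app_left : ∀ {a a' : A} {b : B} (f : a' ⟶ a) (m : M.obj a b),
    app (M.left f m) = N.left f (app m)
  app_right : ∀ {a : A} {b b' : B} (g : b ⟶ b') (m : M.obj a b),
    app (M.right g m) = N.right g (app m)

instance : Category (Prof A B) where
  Hom M N := ProfHom M N
  id M := { app := fun m => m, app_left := fun _ _ => rfl, app_right := fun _ _ => rfl }
  comp σ τ :=
    { app := fun m => τ.app (σ.app m)
      app_left := fun f m => by rw [σ.app_left, τ.app_left]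
      app_right := fun g m => by rw [σ.app_right, τ.app_right] }

/-- The identity lex profunctor, given by the hom-sets. -/
def Prof.ident (A : LexProf.{v}) : Prof A A where
  obj a' a := a' ⟶ a
  left f m := f ≫ m
  right g m := m ≫ g
  left_id m := Category.id_comp m
  left_comp f g m := Category.assoc f g m
  right_id m := Category.comp_id m
  right_comp f g m := (Category.assoc m f g).symm
  left_right f g m := (Category.assoc f m g).symm
  lex a := inferInstanceAs (PreservesFiniteLimits (coyoneda.obj (op a)))

namespace Profunctor

/-- The relation generating the coend `∫ b, N(b, c) × M(a, b)`. -/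
def CoendRel (M : Profunctor A B) (N : Profunctor B C) (a : A) (c : C)
    (s t : Σ b : B, M.obj a b × N.obj b c) : Prop :=
  ∃ β : s.1 ⟶ t.1, M.right β s.2.1 = t.2.1 ∧ N.left β t.2.2 = s.2.2

/-- The coend `∫ b, N(b, c) × M(a, b)`. -/
def Coend (M : Profunctor A B) (N : Profunctor B C) (a : A) (c : C) : Type v :=
  Quot (CoendRel M N a c)

/-- The element of the coend represented by a pair of elements. -/
def pair {M : Profunctor A B} {N : Profunctor B C} {a : A} {b : B} {c : C} (m : M.obj a b)
    (n : N.obj b c) : Coend M N a c := Quot.mk _ ⟨b, m, n⟩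

theorem pair_right {M : Profunctor A B} {N : Profunctor B C} {a : A} {b b' : B} {c : C}
    (β : b ⟶ b') (m : M.obj a b) (n : N.obj b' c) :
    pair (M.right β m) n = pair m (N.left β n) :=
  (Quot.sound ⟨β, rfl, rfl⟩).symm

/-- Functions out of a coend, from dinatural families. -/
def Coend.lift {M : Profunctor A B} {N : Profunctor B C} {a : A} {c : C} {X : Type v}
    (φ : ∀ {b : B}, M.obj a b → N.obj b c → X)
    (h : ∀ {b b' : B} (β : b ⟶ b') (m : M.obj a b) (n : N.obj b' c),
      φ (M.right β m) n = φ m (N.left β n)) (s : Coend M N a c) : X :=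
  Quot.lift (fun s => φ s.2.1 s.2.2) (by
    rintro ⟨b, m, n⟩ ⟨b', m', n'⟩ ⟨β, h1, h2⟩
    dsimp only at h1 h2 ⊢
    rw [← h1, ← h2, h]) s

@[simp]
theorem Coend.lift_pair {M : Profunctor A B} {N : Profunctor B C} {a : A} {b : B} {c : C}
    {X : Type v} (φ : ∀ {b : B}, M.obj a b → N.obj b c → X)
    (h : ∀ {b b' : B} (β : b ⟶ b') (m : M.obj a b) (n : N.obj b' c),
      φ (M.right β m) n = φ m (N.left β n)) (m : M.obj a b) (n : N.obj b c) :
    Coend.lift φ h (pair m n) = φ m n := rfl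

theorem Coend.ind {M : Profunctor A B} {N : Profunctor B C} {a : A} {c : C}
    {p : Coend M N a c → Prop}
    (h : ∀ {b : B} (m : M.obj a b) (n : N.obj b c), p (pair m n)) (s : Coend M N a c) : p s :=
  Quot.ind (fun s => h s.2.1 s.2.2) s

/-- The composite of profunctors. -/
def comp (M : Profunctor A B) (N : Profunctor B C) : Profunctor A C where
  obj a c := Coend M N a c
  left f := Coend.lift (fun m n => pair (M.left f m) n)
    (fun β m n => by rw [M.left_right, pair_right])
  right g := Coend.lift (fun m n => pair m (N.right g n))
    (fun β m n => by rw [pair_right, N.left_right])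
  left_id := Coend.ind fun m n => congrArg (fun m => pair m n) (M.left_id m)
  left_comp f g := Coend.ind fun m n => congrArg (fun m => pair m n) (M.left_comp f g m)
  right_id := Coend.ind fun m n => congrArg (pair m) (N.right_id n)
  right_comp f g := Coend.ind fun m n => congrArg (pair m) (N.right_comp f g n)
  left_right f g := Coend.ind fun m n => rfl

/-- For fixed `a`, the diagram on the category of elements of `M(a, -)` whose colimit is the
coend. -/
def coendDiagram (M : Profunctor A B) (N : Profunctor B C) (a : A) :
    C ⥤ ((M.fib a).Elementsᵒᵖ ⥤ Type v) where
  obj c :=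
    { obj := fun e => N.obj e.unop.1 c
      map := fun e => ↾(N.left e.unop.1)
      map_id := fun e => by ext n; exact N.left_id n
      map_comp := fun f g => by ext n; exact N.left_comp _ _ n }
  map g :=
    { app := fun e => ↾(N.right g)
      naturality := fun e e' f => by ext n; exact (N.left_right _ _ n).symm }
  map_id c := by ext e n; exact N.right_id n
  map_comp f g := by ext e n; exact N.right_comp f g n

/-- The coend as a cocone. -/
def coendCocone (M : Profunctor A B) (N : Profunctor B C) (a : A) (c : C) :
    Cocone ((coendDiagram M N a).obj c) where
  pt := Coend M N a c
  ι :=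
    { app := fun e => ↾(fun n => pair (M := M) e.unop.2 n)
      naturality := fun e e' f => by
        ext n
        have h : M.right f.unop.1 e'.unop.2 = e.unop.2 := f.unop.2
        exact (pair_right f.unop.1 e'.unop.2 n).symm.trans (congrArg (fun m => pair m n) h) }

/-- The coend is a colimit. -/
def coendIsColimit (M : Profunctor A B) (N : Profunctor B C) (a : A) (c : C) :
    IsColimit (coendCocone M N a c) where
  desc s := ↾(Coend.lift (fun {b} m n => s.ι.app (op ⟨b, m⟩) n) (fun {b b'} β m n =>
      (ConcreteCategory.congr_hom (s.w (CategoryOfElements.homMk ((M.fib a).elementsMk b m)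
        ((M.fib a).elementsMk b' (M.right β m)) β rfl).op) n).symm))
  fac s e := by ext n; rfl
  uniq s f hf := by
    ext x
    induction x using Coend.ind with
    | h m n => exact ConcreteCategory.congr_hom (hf (op ⟨_, m⟩)) n

end Profunctor

/-- The composite of lex profunctors. -/
def Prof.comp (M : Prof A B) (N : Prof B C) : Prof A C where
  toProfunctor := M.toProfunctor.comp N.toProfunctor
  lex a := by
    have := M.lex a
    have hN := N.lex
    have : IsCofiltered (M.fib a).Elements := Functor.isCofiltered_elements _
    let F := Profunctor.coendDiagram M.toProfunctor N.toProfunctor a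
    have hF : PreservesFiniteLimits F := by
      constructor
      intro J _ _
      apply preservesLimitsOfShape_of_evaluation
      intro e
      exact (hN e.unop.1).preservesFiniteLimits J
    have : PreservesFiniteLimits (F ⋙ colim) := comp_preservesFiniteLimits _ _
    refine preservesFiniteLimits_of_natIso (F := F ⋙ colim) (NatIso.ofComponents
      (fun c => (colimit.isColimit _).coconePointUniqueUpToIso
        (Profunctor.coendIsColimit M.toProfunctor N.toProfunctor a c)) ?_)
    intro c c' g
    apply colimit.hom_ext
    intro e
    change colimit.ι (F.obj c) e ≫ colimMap (F.map g) ≫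
        ((colimit.isColimit (F.obj c')).coconePointUniqueUpToIso
          (Profunctor.coendIsColimit M.toProfunctor N.toProfunctor a c')).hom =
      colimit.ι (F.obj c) e ≫ ((colimit.isColimit (F.obj c)).coconePointUniqueUpToIso
          (Profunctor.coendIsColimit M.toProfunctor N.toProfunctor a c)).hom ≫
        ((M.toProfunctor.comp N.toProfunctor).fib a).map g
    have h := (colimit.isColimit (F.obj c)).comp_coconePointUniqueUpToIso_hom
      (Profunctor.coendIsColimit M.toProfunctor N.toProfunctor a c) e
    have h' := (colimit.isColimit (F.obj c')).comp_coconePointUniqueUpToIso_hom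
      (Profunctor.coendIsColimit M.toProfunctor N.toProfunctor a c') e
    rw [ι_colimMap_assoc]
    refine (congrArg (fun t => (F.map g).app e ≫ t) h').trans
      (Eq.trans ?_ (congrArg (fun t => t ≫ ((M.toProfunctor.comp N.toProfunctor).fib a).map g)
        h.symm))
    ext n
    rfl

theorem Prof.comp_hom_ext {M : Prof A B} {N : Prof B C} {P : Prof A C} {σ τ : M.comp N ⟶ P}
    (h : ∀ {a : A} {b : B} {c : C} (m : M.obj a b) (n : N.obj b c),
      ProfHom.app σ (Profunctor.pair m n) = ProfHom.app τ (Profunctor.pair m n)) : σ = τ :=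
  ProfHom.ext (by
    funext a c s
    exact Profunctor.Coend.ind (p := fun s => ProfHom.app σ s = ProfHom.app τ s) h s)

theorem Prof.comp_comp_hom_ext {M : Prof A B} {N : Prof B C} {P : Prof C D} {Q : Prof A D}
    {σ τ : (M.comp N).comp P ⟶ Q}
    (h : ∀ {a : A} {b : B} {c : C} {d : D} (m : M.obj a b) (n : N.obj b c) (p : P.obj c d),
      ProfHom.app σ (Profunctor.pair (M := (M.comp N).toProfunctor) (Profunctor.pair m n) p) =
        ProfHom.app τ (Profunctor.pair (M := (M.comp N).toProfunctor) (Profunctor.pair m n) p)) :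
    σ = τ :=
  Prof.comp_hom_ext fun s p => by
    induction s using Profunctor.Coend.ind with
    | h m n => exact h m n p

theorem Prof.comp_comp_hom_ext' {M : Prof A B} {N : Prof B C} {P : Prof C D} {Q : Prof A D}
    {σ τ : M.comp (N.comp P) ⟶ Q}
    (h : ∀ {a : A} {b : B} {c : C} {d : D} (m : M.obj a b) (n : N.obj b c) (p : P.obj c d),
      ProfHom.app σ (Profunctor.pair (N := (N.comp P).toProfunctor) m (Profunctor.pair n p)) =
        ProfHom.app τ (Profunctor.pair (N := (N.comp P).toProfunctor) m (Profunctor.pair n p))) :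
    σ = τ :=
  Prof.comp_hom_ext fun m t => by
    induction t using Profunctor.Coend.ind with
    | h n p => exact h m n p

/-- Left whiskering of maps of lex profunctors. -/
def Prof.whiskerLeft (M : Prof A B) {N N' : Prof B C} (σ : N ⟶ N') : M.comp N ⟶ M.comp N' :=
  ({ app := Profunctor.Coend.lift (fun m n => Profunctor.pair m (ProfHom.app σ n))
      (fun β m n => by rw [Profunctor.pair_right, ProfHom.app_left])
     app_left := fun f => Profunctor.Coend.ind fun m n => rfl
     app_right := fun g => Profunctor.Coend.ind fun m n =>
      congrArg (Profunctor.pair m) (ProfHom.app_right σ g n) } : ProfHom _ _)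

/-- Right whiskering of maps of lex profunctors. -/
def Prof.whiskerRight {M M' : Prof A B} (σ : M ⟶ M') (N : Prof B C) : M.comp N ⟶ M'.comp N :=
  ({ app := Profunctor.Coend.lift (fun m n => Profunctor.pair (ProfHom.app σ m) n)
      (fun β m n => by rw [ProfHom.app_right, Profunctor.pair_right])
     app_left := fun f => Profunctor.Coend.ind fun m n =>
      congrArg (fun m => Profunctor.pair m n) (ProfHom.app_left σ f m)
     app_right := fun g => Profunctor.Coend.ind fun m n => rfl } : ProfHom _ _)

/-- The associator on elements. -/
def Profunctor.assocFun {M : Profunctor A B} {N : Profunctor B C} {P : Profunctor C D} {a : A}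
    {d : D} : Coend (M.comp N) P a d → Coend M (N.comp P) a d :=
  Coend.lift
    (fun s p => Coend.lift (fun m n => pair (N := N.comp P) m (pair n p))
      (fun β m n => pair_right (N := N.comp P) β m (pair n p)) s)
    (fun γ s p => by
      induction s using Coend.ind with
      | h m n => exact congrArg (pair (N := N.comp P) m) (pair_right γ n p))

/-- The inverse associator on elements. -/
def Profunctor.assocInvFun {M : Profunctor A B} {N : Profunctor B C} {P : Profunctor C D} {a : A}
    {d : D} : Coend M (N.comp P) a d → Coend (M.comp N) P a d :=
  Coend.lift
    (fun m t => Coend.lift (fun n p => pair (M := M.comp N) (pair m n) p)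
      (fun γ n p => pair_right (M := M.comp N) γ (pair m n) p) t)
    (fun β m t => by
      induction t using Coend.ind with
      | h n p => exact congrArg (fun s => pair (M := M.comp N) s p) (pair_right β m n))

/-- The associator. -/
def Prof.assoc (M : Prof A B) (N : Prof B C) (P : Prof C D) :
    (M.comp N).comp P ≅ M.comp (N.comp P) where
  hom :=
    ({ app := Profunctor.assocFun
       app_left := fun f s => by
          induction s using Profunctor.Coend.ind with
          | h s p =>
            induction s using Profunctor.Coend.ind with
            | h m n => rfl
       app_right := fun f s => by
          induction s using Profunctor.Coend.ind with
          | h s p =>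
            induction s using Profunctor.Coend.ind with
            | h m n => rfl } : ProfHom _ _)
  inv :=
    ({ app := Profunctor.assocInvFun
       app_left := fun f s => by
          induction s using Profunctor.Coend.ind with
          | h m t =>
            induction t using Profunctor.Coend.ind with
            | h n p => rfl
       app_right := fun f s => by
          induction s using Profunctor.Coend.ind with
          | h m t =>
            induction t using Profunctor.Coend.ind with
            | h n p => rfl } : ProfHom _ _)
  hom_inv_id := Prof.comp_comp_hom_ext fun m n p => rfl
  inv_hom_id := Prof.comp_comp_hom_ext' fun m n p => rfl

/-- The left unitor. -/
def Prof.leftUnitor (M : Prof A B) : (Prof.ident A).comp M ≅ M where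
  hom :=
    ({ app := Profunctor.Coend.lift (fun (f : _ ⟶ _) m => M.left f m)
        (fun β f m => M.left_comp f β m)
       app_left := fun f => Profunctor.Coend.ind fun g m => M.left_comp f g m
       app_right := fun g => Profunctor.Coend.ind fun f m => M.left_right f g m } : ProfHom _ _)
  inv :=
    ({ app := fun {a b} m => Profunctor.pair (M := (Prof.ident A).toProfunctor) (𝟙 a) m
       app_left := fun {a a' b} f m =>
        (Profunctor.pair_right (M := (Prof.ident A).toProfunctor) f (𝟙 a') m).symm.trans
          (congrArg (fun h => Profunctor.pair (M := (Prof.ident A).toProfunctor) h m)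
            ((Category.id_comp f).trans (Category.comp_id f).symm))
       app_right := fun g m => rfl } : ProfHom _ _)
  hom_inv_id := Prof.comp_hom_ext fun {a a' b} f m =>
    (Profunctor.pair_right (M := (Prof.ident A).toProfunctor) f (𝟙 a) m).symm.trans
      (congrArg (fun h => Profunctor.pair (M := (Prof.ident A).toProfunctor) h m)
        (Category.id_comp f))
  inv_hom_id := ProfHom.ext (by funext a b m; exact M.left_id m)

/-- The right unitor. -/
def Prof.rightUnitor (M : Prof A B) : M.comp (Prof.ident B) ≅ M where
  hom :=
    ({ app := Profunctor.Coend.lift (fun m (g : _ ⟶ _) => M.right g m)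
        (fun β m g => (M.right_comp β g m).symm)
       app_left := fun f => Profunctor.Coend.ind fun m g => (M.left_right f g m).symm
       app_right := fun g => Profunctor.Coend.ind fun m f => M.right_comp f g m } : ProfHom _ _)
  inv :=
    ({ app := fun {a b} m => Profunctor.pair (N := (Prof.ident B).toProfunctor) m (𝟙 b)
       app_left := fun f m => rfl
       app_right := fun {a b b'} g m =>
        (Profunctor.pair_right (N := (Prof.ident B).toProfunctor) g m (𝟙 b')).trans
          (congrArg (Profunctor.pair (N := (Prof.ident B).toProfunctor) m)
            ((Category.comp_id g).trans (Category.id_comp g).symm)) } : ProfHom _ _)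
  hom_inv_id := Prof.comp_hom_ext fun {a b b'} m g =>
    (Profunctor.pair_right (N := (Prof.ident B).toProfunctor) g m (𝟙 b')).trans
      (congrArg (Profunctor.pair (N := (Prof.ident B).toProfunctor) m) (Category.comp_id g))
  inv_hom_id := ProfHom.ext (by funext a b m; exact M.right_id m)

instance : Bicategory LexProf.{v} where
  Hom A B := Prof A B
  id A := Prof.ident A
  comp M N := M.comp N
  whiskerLeft M _ _ σ := Prof.whiskerLeft M σ
  whiskerRight σ N := Prof.whiskerRight σ N
  associator M N P := Prof.assoc M N P
  leftUnitor M := Prof.leftUnitor M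
  rightUnitor M := Prof.rightUnitor M
  whiskerLeft_id M N :=
    show Prof.whiskerLeft M (𝟙 N) = 𝟙 (M.comp N) from Prof.comp_hom_ext fun _ _ => rfl
  whiskerLeft_comp M _ _ _ σ τ :=
    show Prof.whiskerLeft M (σ ≫ τ) = Prof.whiskerLeft M σ ≫ Prof.whiskerLeft M τ from
    Prof.comp_hom_ext fun _ _ => rfl
  id_whiskerLeft {A B M N} σ :=
    ((Iso.comp_inv_eq (Prof.leftUnitor N)).mpr
      (Prof.comp_hom_ext (fun f m => (ProfHom.app_left σ f m)))).symm.trans (Category.assoc _ _ _)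
  comp_whiskerLeft M N _ _ σ :=
    show Prof.whiskerLeft (M.comp N) σ = (Prof.assoc M N _).hom ≫
      Prof.whiskerLeft M (Prof.whiskerLeft N σ) ≫ (Prof.assoc M N _).inv from
    Prof.comp_comp_hom_ext fun _ _ _ => rfl
  id_whiskerRight M N :=
    show Prof.whiskerRight (𝟙 M) N = 𝟙 (M.comp N) from Prof.comp_hom_ext fun _ _ => rfl
  comp_whiskerRight σ τ N :=
    show Prof.whiskerRight (σ ≫ τ) N = Prof.whiskerRight σ N ≫ Prof.whiskerRight τ N from
    Prof.comp_hom_ext fun _ _ => rfl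
  whiskerRight_id {A B M N} σ :=
    ((Iso.comp_inv_eq (Prof.rightUnitor N)).mpr
      (Prof.comp_hom_ext (fun m g => (ProfHom.app_right σ g m)))).symm.trans (Category.assoc _ _ _)
  whiskerRight_comp σ N P :=
    show Prof.whiskerRight σ (N.comp P) = (Prof.assoc _ N P).inv ≫
      Prof.whiskerRight (Prof.whiskerRight σ N) P ≫ (Prof.assoc _ N P).hom from
    Prof.comp_comp_hom_ext' fun _ _ _ => rfl
  whisker_assoc M _ _ σ P :=
    show Prof.whiskerRight (Prof.whiskerLeft M σ) P = (Prof.assoc M _ P).hom ≫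
      Prof.whiskerLeft M (Prof.whiskerRight σ P) ≫ (Prof.assoc M _ P).inv from
    Prof.comp_comp_hom_ext fun _ _ _ => rfl
  whisker_exchange {A B C M M' N N'} σ τ :=
    show Prof.whiskerLeft M τ ≫ Prof.whiskerRight σ N' =
      Prof.whiskerRight σ N ≫ Prof.whiskerLeft M' τ from
    Prof.comp_hom_ext (M := M) (N := N) fun _ _ => rfl
  pentagon K L M N := Prof.comp_comp_hom_ext fun s m n =>
    Profunctor.Coend.ind (M := K.toProfunctor) (N := L.toProfunctor)
      (p := fun s =>
        ProfHom.app (Prof.whiskerRight (Prof.assoc K L M).hom N ≫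
          (Prof.assoc K (L.comp M) N).hom ≫ Prof.whiskerLeft K (Prof.assoc L M N).hom)
          (Profunctor.pair (M := ((K.comp L).comp M).toProfunctor) (Profunctor.pair s m) n) =
        ProfHom.app ((Prof.assoc (K.comp L) M N).hom ≫ (Prof.assoc K L (M.comp N)).hom)
          (Profunctor.pair (M := ((K.comp L).comp M).toProfunctor) (Profunctor.pair s m) n))
      (fun _ _ => rfl) s
  triangle M N := Prof.comp_comp_hom_ext fun m β n =>
    (Profunctor.pair_right (M := M.toProfunctor) (N := N.toProfunctor) β m n).symm

end LexProf

/-! ## Partially finitely complete categories -/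

/-- A left-exact sieve on a category. -/
structure LexSieve (C : Type (v + 1)) [Category.{v} C] where
  /-- The members with a given domain. -/
  mem : ∀ A : LexProf.{v}, Set (A ⥤ C)
  lex : ∀ {A : LexProf.{v}} {X : A ⥤ C}, X ∈ mem A → PreservesFiniteLimits X
  comp_mem : ∀ {A B : LexProf.{v}} {X : B ⥤ C}, X ∈ mem B →
    ∀ (G : A ⥤ B), PreservesFiniteLimits G → G ⋙ X ∈ mem A
  iso_mem : ∀ {A : LexProf.{v}} {X Y : A ⥤ C}, X ∈ mem A → (X ≅ Y) → Y ∈ mem A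
  cover : ∀ c : C, ∃ (A : LexProf.{v}) (X : A ⥤ C), X ∈ mem A ∧ ∃ i : A, X.obj i = c

/-- A partially finitely complete category: a (locally small, possibly large) category with a
left-exact sieve. -/
structure ParFL : Type (v + 2) where
  /-- The underlying type of objects. -/
  carrier : Type (v + 1)
  [cat : Category.{v} carrier]
  /-- The left-exact sieve. -/
  sieve : LexSieve carrier

namespace ParFL

instance : CoeSort ParFL.{v} (Type (v + 1)) := ⟨carrier⟩

attribute [instance] cat

/-- A partially finite-limit-preserving functor. -/
structure Hom (C D : ParFL.{v}) where
  /-- The underlying functor. -/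
  functor : C ⥤ D
  comp_mem : ∀ {A : LexProf.{v}} {X : A ⥤ C}, X ∈ C.sieve.mem A → X ⋙ functor ∈ D.sieve.mem A

instance (C D : ParFL.{v}) : Category (Hom C D) where
  Hom F G := F.functor ⟶ G.functor
  id F := 𝟙 F.functor
  comp α β := α ≫ β

/-- The identity partially finite-limit-preserving functor. -/
abbrev Hom.id (C : ParFL.{v}) : Hom C C where
  functor := 𝟭 C
  comp_mem h := h

/-- Composition of partially finite-limit-preserving functors. -/
abbrev Hom.comp {C D E : ParFL.{v}} (F : Hom C D) (G : Hom D E) : Hom C E where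
  functor := F.functor ⋙ G.functor
  comp_mem h := G.comp_mem (F.comp_mem h)

/-- An isomorphism of underlying functors. -/
def Hom.isoMk {C D : ParFL.{v}} {F G : Hom C D} (e : F.functor ≅ G.functor) : F ≅ G where
  hom := e.hom
  inv := e.inv
  hom_inv_id := e.hom_inv_id
  inv_hom_id := e.inv_hom_id

/-- The 2-category of partially finitely complete categories, partially finite-limit-preserving
functors and natural transformations. -/
instance : Bicategory ParFL.{v} where
  Hom C D := Hom C D
  id C := Hom.id C
  comp F G := F.comp G
  whiskerLeft F _ _ α := Functor.whiskerLeft F.functor α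
  whiskerRight α H := Functor.whiskerRight α H.functor
  associator F G H := Hom.isoMk (F := (F.comp G).comp H)
    (G := F.comp (G.comp H)) (Functor.associator F.functor G.functor H.functor)
  leftUnitor F := Hom.isoMk (F := (Hom.id _).comp F) F.functor.leftUnitor
  rightUnitor F := Hom.isoMk (F := F.comp (Hom.id _)) F.functor.rightUnitor
  whiskerLeft_id F _ := Functor.whiskerLeft_id F.functor
  whiskerLeft_comp F _ _ _ α β := Functor.whiskerLeft_comp F.functor α β
  id_whiskerLeft α := by
    apply NatTrans.ext
    funext x
    exact ((Category.id_comp _).trans (Category.comp_id _)).symm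
  comp_whiskerLeft _ _ _ _ α := by
    apply NatTrans.ext
    funext x
    exact ((Category.id_comp _).trans (Category.comp_id _)).symm
  id_whiskerRight _ G := Functor.whiskerRight_id' G.functor
  comp_whiskerRight α β G := Functor.whiskerRight_comp α β G.functor
  whiskerRight_id α := by
    apply NatTrans.ext
    funext x
    exact ((Category.id_comp _).trans (Category.comp_id _)).symm
  whiskerRight_comp α _ _ := by
    apply NatTrans.ext
    funext x
    exact ((Category.id_comp _).trans (Category.comp_id _)).symm
  whisker_assoc _ _ _ α _ := by
    apply NatTrans.ext
    funext x
    exact ((Category.id_comp _).trans (Category.comp_id _)).symm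
  whisker_exchange α β := by
    apply NatTrans.ext
    funext x
    exact (NatTrans.naturality β (NatTrans.app α x)).symm
  pentagon F G H K := Functor.pentagon F.functor G.functor H.functor K.functor
  triangle F G := Functor.triangle F.functor G.functor

instance : Bicategory.Strict ParFL.{v} where
  id_comp _ := rfl
  comp_id _ := rfl
  assoc _ _ _ := rfl
  leftUnitor_eqToIso _ := Iso.ext rfl
  rightUnitor_eqToIso _ := Iso.ext rfl
  associator_eqToIso _ _ _ := Iso.ext rfl

end ParFL

/-! ## The 2-functor `Γ` -/

/-- The 2-category of `LexProf`-categories. -/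
abbrev LexProfCat : Type (v + 2) := WCategory.{v, v + 1, v + 1, v + 1} LexProf.{v}

namespace ParFL

open LexProf

/-- The lex profunctor `C(X-, Y-)`. -/
def homProf {C : ParFL.{v}} {A B : LexProf.{v}} (X : A ⥤ C) (Y : B ⥤ C)
    (hY : PreservesFiniteLimits Y) : Prof A B where
  obj i j := X.obj i ⟶ Y.obj j
  left f m := X.map f ≫ m
  right g m := m ≫ Y.map g
  left_id m := by simp
  left_comp f g m := by simp
  right_id m := by simp
  right_comp f g m := by simp
  left_right f g m := by simp
  lex i := (inferInstance : PreservesFiniteLimits (Y ⋙ coyoneda.obj (op (X.obj i))))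

/-- The `LexProf`-category `Γ(C)`. -/
def gammaObj (C : ParFL.{v}) : LexProfCat.{v} where
  Obj A := { X : A ⥤ C // X ∈ C.sieve.mem A }
  hom X Y := show Prof _ _ from homProf X.1 Y.1 (C.sieve.lex Y.2)
  comp X Y Z :=
    ({ app := Profunctor.Coend.lift (fun (f : X.1.obj _ ⟶ Y.1.obj _) (g : _ ⟶ Z.1.obj _) => f ≫ g)
        (fun β f g => Category.assoc f (Y.1.map β) g)
       app_left := fun f => Profunctor.Coend.ind fun m n => Category.assoc (X.1.map f) m n
       app_right := fun g => Profunctor.Coend.ind fun m n =>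
        (Category.assoc m n (Z.1.map g)).symm } :
      ProfHom ((homProf X.1 Y.1 (C.sieve.lex Y.2)).comp (homProf Y.1 Z.1 (C.sieve.lex Z.2)))
        (homProf X.1 Z.1 (C.sieve.lex Z.2)))
  ident X :=
    ({ app := fun f => X.1.map f
       app_left := fun f m => X.1.map_comp f m
       app_right := fun g m => X.1.map_comp m g } :
      ProfHom (Prof.ident _) (homProf X.1 X.1 (C.sieve.lex X.2)))
  ident_comp X Y := Prof.comp_hom_ext fun _ _ => rfl
  comp_ident X Y := Prof.comp_hom_ext fun _ _ => rfl
  comp_assoc X Y Z T := Prof.comp_comp_hom_ext fun f g h => Category.assoc f g h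

/-- The `LexProf`-functor `Γ(F)`. -/
def gammaMap {C D : ParFL.{v}} (F : Hom C D) : WFunctor (gammaObj C) (gammaObj D) where
  obj X := ⟨X.1 ⋙ F.functor, F.comp_mem X.2⟩
  map X Y :=
    ({ app := fun f => F.functor.map f
       app_left := fun f m => F.functor.map_comp (X.1.map f) m
       app_right := fun g m => F.functor.map_comp m (Y.1.map g) } :
      ProfHom (homProf X.1 Y.1 (C.sieve.lex Y.2))
        (homProf (X.1 ⋙ F.functor) (Y.1 ⋙ F.functor) (D.sieve.lex (F.comp_mem Y.2))))
  map_ident X := rfl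
  map_comp X Y Z := Prof.comp_hom_ext fun f g => F.functor.map_comp f g

/-- The `LexProf`-transformation `Γ(α)`, whose component at `X` sends `f : i ⟶ j` to
`α_{Xj} ∘ FXf = GXf ∘ α_{Xi}`. -/
def gammaMap₂ {C D : ParFL.{v}} {F G : Hom C D} (α : F.functor ⟶ G.functor) :
    WTrans (gammaMap F) (gammaMap G) where
  app {A} X :=
    ({ app := fun {i j} (f : i ⟶ j) => α.app (X.1.obj i) ≫ G.functor.map (X.1.map f)
       app_left := fun {i i' j} f m => by
        change i ⟶ j at m
        change α.app (X.1.obj i') ≫ G.functor.map (X.1.map (f ≫ m)) =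
          F.functor.map (X.1.map f) ≫ α.app (X.1.obj i) ≫ G.functor.map (X.1.map m)
        simp
       app_right := fun {i j j'} g m => by
        change i ⟶ j at m
        change α.app (X.1.obj i) ≫ G.functor.map (X.1.map (m ≫ g)) =
          (α.app (X.1.obj i) ≫ G.functor.map (X.1.map m)) ≫ G.functor.map (X.1.map g)
        simp } :
      ProfHom (Prof.ident A) (homProf (X.1 ⋙ F.functor) (X.1 ⋙ G.functor)
        (D.sieve.lex (G.comp_mem X.2))))
  naturality X Y := ProfHom.ext (by
    funext i j f
    change X.1.obj i ⟶ Y.1.obj j at f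
    change F.functor.map f ≫ α.app (Y.1.obj j) ≫ G.functor.map (Y.1.map (𝟙 j)) =
      (α.app (X.1.obj i) ≫ G.functor.map (X.1.map (𝟙 i))) ≫ G.functor.map f
    simp)

@[simp]
theorem gammaMap₂_app {C D : ParFL.{v}} {F G : Hom C D} (α : F.functor ⟶ G.functor)
    {A : LexProf.{v}} (X : (gammaObj C).Obj A) {i j : A} (f : i ⟶ j) :
    ProfHom.app ((gammaMap₂ α).app X) f = α.app (X.1.obj i) ≫ G.functor.map (X.1.map f) := rfl

theorem wtrans_ext {C D : LexProfCat.{v}} {F G : WFunctor C D} {α β : WTrans F G}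
    (h : ∀ {A : LexProf.{v}} (X : C.Obj A) {i j : A} (f : i ⟶ j),
      ProfHom.app (α.app X) (a := i) (b := j) f = ProfHom.app (β.app X) (a := i) (b := j) f) :
    α = β :=
  WTrans.ext (by
    funext A X
    apply ProfHom.ext
    funext i j f
    exact h X f)

theorem _root_.CategoryTheory.eq_eqToHom_comp_comp {K : Type*} [Category K] {a b c d : K}
    (h : a = b) (h' : c = d) {x : a ⟶ c} {y : b ⟶ d} (hxy : HEq x y) :
    x = eqToHom h ≫ y ≫ eqToHom h'.symm := by
  subst h h'
  simpa using hxy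

theorem _root_.CategoryTheory.eq_eqToHom_comp {K : Type*} [Category K] {a b c : K}
    (h : a = b) {x : a ⟶ c} {y : b ⟶ c} (hxy : HEq x y) : x = eqToHom h ≫ y := by
  subst h
  simpa using hxy

/-- The 2-functor `Γ`. -/
def Gamma : StrictPseudofunctor ParFL.{v} LexProfCat.{v} :=
  StrictPseudofunctor.mk'
    { obj := gammaObj
      map := fun F => gammaMap F
      map₂ := fun α => gammaMap₂ α
      map₂_id := fun F => wtrans_ext fun X i j f => Category.id_comp _
      map₂_comp := fun {C D F G H} α β => wtrans_ext fun X i j f => by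
        change (NatTrans.app α (X.1.obj i) ≫ NatTrans.app β (X.1.obj i)) ≫
            H.functor.map (X.1.map f) =
          (NatTrans.app α (X.1.obj i) ≫ G.functor.map (X.1.map (𝟙 i))) ≫
            NatTrans.app β (X.1.obj i) ≫ H.functor.map (X.1.map f)
        simp
      map_id := fun C => rfl
      map_comp := fun F G => rfl
      map₂_whisker_left := fun {C D E} F G H α => by
        refine eq_eqToHom_comp_comp (K := gammaObj C ⟶ gammaObj E) rfl rfl ?_
        apply heq_of_eq
        apply wtrans_ext
        intro A X i j f
        rfl
      map₂_whisker_right := fun {C D E} F G α H => by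
        refine eq_eqToHom_comp_comp (K := gammaObj C ⟶ gammaObj E) rfl rfl ?_
        apply heq_of_eq
        apply wtrans_ext
        intro A X i j f
        exact (H.functor.map_comp _ _).symm
      map₂_left_unitor := fun {C E} F => by
        refine eq_eqToHom_comp (K := gammaObj C ⟶ gammaObj E) rfl ?_
        apply heq_of_eq
        apply wtrans_ext
        intro A X i j f
        exact Category.id_comp _
      map₂_right_unitor := fun {C E} F => by
        refine eq_eqToHom_comp (K := gammaObj C ⟶ gammaObj E) rfl ?_
        apply heq_of_eq
        apply wtrans_ext
        intro A X i j f
        exact Category.id_comp _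
      map₂_associator := fun {C D D' E} F G H => by
        refine eq_eqToHom_comp_comp (K := gammaObj C ⟶ gammaObj E) rfl rfl ?_
        apply heq_of_eq
        apply wtrans_ext
        intro A X i j f
        exact Category.id_comp _ }

end ParFL

/-! ## The 2-functor `∫` -/

namespace ParFL

open LexProf

variable {C D E : LexProfCat.{v}}

/-- The set `C(X, Y)(i, j)`. -/
def el (C : LexProfCat.{v}) {A B : LexProf.{v}} (X : C.Obj A) (Y : C.Obj B) (i : A) (j : B) :
    Type v :=
  (show Prof A B from C.hom X Y).obj i j

/-- The identity element in `C(X, X)(i, i')` given by a map `i ⟶ i'`. -/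
def elId (C : LexProfCat.{v}) {A : LexProf.{v}} (X : C.Obj A) {i i' : A} (φ : i ⟶ i') :
    el C X X i i' :=
  ProfHom.app (M := Prof.ident A) (N := C.hom X X) (C.ident X) φ

/-- Composition of elements of hom-objects. -/
def elComp {A B K : LexProf.{v}} {X : C.Obj A} {Y : C.Obj B} {Z : C.Obj K} {i : A} {j : B} {k : K}
    (f : el C X Y i j) (g : el C Y Z j k) : el C X Z i k :=
  ProfHom.app (M := Prof.comp (C.hom X Y) (C.hom Y Z)) (N := C.hom X Z) (C.comp X Y Z)
    (Profunctor.pair f g)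

section

variable {A B K L : LexProf.{v}} {X : C.Obj A} {Y : C.Obj B} {Z : C.Obj K} {T : C.Obj L}

theorem elId_elComp {i i' : A} {j : B} (φ : i ⟶ i') (f : el C X Y i' j) :
    elComp (elId C X φ) f = Profunctor.left _ φ f :=
  congrArg (fun σ : ProfHom ((Prof.ident A).comp (C.hom X Y)) (C.hom X Y) =>
    σ.app (Profunctor.pair φ f)) (C.ident_comp X Y)

theorem elComp_elId {i : A} {j j' : B} (f : el C X Y i j) (φ : j ⟶ j') :
    elComp f (elId C Y φ) = Profunctor.right _ φ f :=
  congrArg (fun σ : ProfHom ((show Prof A B from C.hom X Y).comp (Prof.ident B)) (C.hom X Y) =>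
    σ.app (Profunctor.pair f φ)) (C.comp_ident X Y)

theorem elComp_assoc {i : A} {j : B} {k : K} {l : L} (f : el C X Y i j) (g : el C Y Z j k)
    (h : el C Z T k l) : elComp (elComp f g) h = elComp f (elComp g h) :=
  congrArg (fun σ : ProfHom (((show Prof A B from C.hom X Y).comp (C.hom Y Z)).comp (C.hom Z T))
    (C.hom X T) => σ.app (Profunctor.pair (Profunctor.pair f g) h)) (C.comp_assoc X Y Z T)

end

/-- The objects `(X, i)` of `∫ C`. -/
structure IntObj (C : LexProfCat.{v}) : Type (v + 1) where
  /-- The extent of `X`. -/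
  ext : LexProf.{v}
  /-- The object `X`. -/
  pt : C.Obj ext
  /-- The object `i` of the extent of `X`. -/
  elt : ext

/-- The category `∫ C`: a morphism `(X, i) ⟶ (Y, j)` is an element of `C(X, Y)(i, j)`. -/
instance (C : LexProfCat.{v}) : Category.{v} (IntObj C) where
  Hom x y := el C x.pt y.pt x.elt y.elt
  id x := elId C x.pt (𝟙 x.elt)
  comp f g := elComp f g
  id_comp f := (elId_elComp _ f).trans (Profunctor.left_id _ f)
  comp_id f := (elComp_elId f _).trans (Profunctor.right_id _ f)
  assoc f g h := elComp_assoc f g h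

/-- The functor `A ⥤ ∫ C` induced by an object `X` of `C` of extent `A`, sending `i` to
`(X, i)`. -/
def iota (C : LexProfCat.{v}) {A : LexProf.{v}} (X : C.Obj A) : A ⥤ IntObj C where
  obj i := ⟨A, X, i⟩
  map φ := elId C X φ
  map_id i := rfl
  map_comp φ ψ :=
    (ProfHom.app_right (M := Prof.ident A) (N := C.hom X X) (C.ident X) ψ φ).trans
      (elComp_elId (elId C X φ) ψ).symm

theorem iota_lex (C : LexProfCat.{v}) {A : LexProf.{v}} (X : C.Obj A) :
    PreservesFiniteLimits (iota C X) := by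
  refine ⟨fun J _ _ => ⟨fun {K} => ⟨fun {c} hc => ⟨coyonedaJointlyReflectsLimits _ _ fun x => ?_⟩⟩⟩⟩
  have e : iota C X ⋙ coyoneda.obj (op x.unop) ≅
      Profunctor.fib (Prof.toProfunctor (C.hom x.unop.pt X)) x.unop.elt :=
    NatIso.ofComponents (fun j => Iso.refl _) (by
      intro j j' φ
      ext f
      exact elComp_elId f φ)
  have := Prof.lex (C.hom x.unop.pt X) x.unop.elt
  have : PreservesFiniteLimits (iota C X ⋙ coyoneda.obj (op x.unop)) :=
    preservesFiniteLimits_of_natIso e.symm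
  exact isLimitOfPreserves (iota C X ⋙ coyoneda.obj (op x.unop)) hc

/-- The partially finitely complete category `∫ C`. -/
def intObj (C : LexProfCat.{v}) : ParFL.{v} where
  carrier := IntObj C
  sieve :=
    { mem := fun A => { G | ∃ (B : LexProf.{v}) (Y : C.Obj B) (F : A ⥤ B),
        PreservesFiniteLimits F ∧ Nonempty (G ≅ F ⋙ iota C Y) }
      lex := by
        rintro A G ⟨B, Y, F, hF, ⟨e⟩⟩
        have := iota_lex C Y
        exact preservesFiniteLimits_of_natIso e.symm
      comp_mem := by
        rintro A A' G ⟨B, Y, F, hF, ⟨e⟩⟩ H hH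
        exact ⟨B, Y, H ⋙ F, comp_preservesFiniteLimits H F, ⟨Functor.isoWhiskerLeft H e⟩⟩
      iso_mem := by
        rintro A G G' ⟨B, Y, F, hF, ⟨e⟩⟩ e'
        exact ⟨B, Y, F, hF, ⟨e'.symm ≪≫ e⟩⟩
      cover := fun c => ⟨c.ext, iota C c.pt,
        ⟨c.ext, c.pt, 𝟭 _, inferInstance, ⟨Iso.refl _⟩⟩, c.elt, rfl⟩ }

theorem iota_mem (C : LexProfCat.{v}) {A : LexProf.{v}} (X : C.Obj A) :
    iota C X ∈ (intObj C).sieve.mem A :=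
  ⟨A, X, 𝟭 _, inferInstance, ⟨Iso.refl _⟩⟩

/-- The action of a `LexProf`-functor on elements of hom-objects. -/
def elMap (F : WFunctor C D) {A B : LexProf.{v}} {X : C.Obj A} {Y : C.Obj B} {i : A} {j : B}
    (f : el C X Y i j) : el D (F.obj X) (F.obj Y) i j :=
  ProfHom.app (M := C.hom X Y) (N := D.hom (F.obj X) (F.obj Y)) (F.map X Y) f

theorem elMap_elId (F : WFunctor C D) {A : LexProf.{v}} {X : C.Obj A} {i j : A} (φ : i ⟶ j) :
    elMap F (elId C X φ) = elId D (F.obj X) φ :=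
  congrArg (fun σ : ProfHom (Prof.ident A) (D.hom (F.obj X) (F.obj X)) => σ.app φ) (F.map_ident X)

theorem elMap_elComp (F : WFunctor C D) {A B K : LexProf.{v}} {X : C.Obj A} {Y : C.Obj B}
    {Z : C.Obj K} {i : A} {j : B} {k : K} (f : el C X Y i j) (g : el C Y Z j k) :
    elMap F (elComp f g) = elComp (elMap F f) (elMap F g) :=
  congrArg (fun σ : ProfHom ((show Prof A B from C.hom X Y).comp (C.hom Y Z))
    (D.hom (F.obj X) (F.obj Z)) => σ.app (Profunctor.pair f g)) (F.map_comp X Y Z)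

/-- The functor underlying `∫ F`. -/
def intFunctor (F : WFunctor C D) : IntObj C ⥤ IntObj D where
  obj x := ⟨x.ext, F.obj x.pt, x.elt⟩
  map f := elMap F f
  map_id x := elMap_elId F _
  map_comp f g := elMap_elComp F f g

/-- `∫ F ∘ ι_X = ι_{FX}`. -/
def iotaIntFunctor (F : WFunctor C D) {A : LexProf.{v}} (X : C.Obj A) :
    iota C X ⋙ intFunctor F ≅ iota D (F.obj X) :=
  NatIso.ofComponents (fun i => Iso.refl _) (by
    intro i j φ
    refine (Category.comp_id _).trans (Eq.trans ?_ (Category.id_comp _).symm)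
    exact elMap_elId F φ)

/-- The partially finite-limit-preserving functor `∫ F`. -/
def intMap (F : WFunctor C D) : Hom (intObj C) (intObj D) where
  functor := intFunctor F
  comp_mem := by
    rintro A G ⟨B, Y, H, hH, ⟨e⟩⟩
    exact ⟨B, F.obj Y, H, hH, ⟨Functor.isoWhiskerRight e (intFunctor F) ≪≫
      Functor.associator _ _ _ ≪≫ Functor.isoWhiskerLeft H (iotaIntFunctor F Y)⟩⟩

/-- The component in `D(FX, GX)(i, i)` of a transformation at an object `i` of the extent. -/
def elApp {F G : WFunctor C D} (α : WTrans F G) {A : LexProf.{v}} (X : C.Obj A) (i : A) :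
    el D (F.obj X) (G.obj X) i i :=
  ProfHom.app (M := Prof.ident A) (N := D.hom (F.obj X) (G.obj X)) (α.app X) (𝟙 i)

theorem elApp_naturality {F G : WFunctor C D} (α : WTrans F G) {A B : LexProf.{v}} {X : C.Obj A}
    {Y : C.Obj B} {i : A} {j : B} (f : el C X Y i j) :
    elComp (elMap F f) (elApp α Y j) = elComp (elApp α X i) (elMap G f) :=
  congrArg (fun σ : ProfHom (C.hom X Y) (D.hom (F.obj X) (G.obj Y)) => σ.app f)
    (α.naturality X Y)

/-- The natural transformation `∫ α`. -/
def intMap₂ {F G : WFunctor C D} (α : WTrans F G) : intFunctor F ⟶ intFunctor G where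
  app x := elApp α x.pt x.elt
  naturality x y f := elApp_naturality α f

/-- The 2-functor `∫`. -/
def Integral : StrictPseudofunctor LexProfCat.{v} ParFL.{v} :=
  StrictPseudofunctor.mk'
    { obj := intObj
      map := fun F => intMap F
      map₂ := fun α => intMap₂ α
      map₂_id := fun F => rfl
      map₂_comp := fun {C D F G H} α β => rfl
      map_id := fun C => rfl
      map_comp := fun F G => rfl
      map₂_whisker_left := fun {C D E} F G H α => by
        refine eq_eqToHom_comp_comp (K := intObj C ⟶ intObj E)
          (show intMap (F.comp G) = (intMap F).comp (intMap G) from rfl)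
          (show intMap (F.comp H) = (intMap F).comp (intMap H) from rfl) ?_
        exact heq_of_eq (NatTrans.ext (by funext x; rfl))
      map₂_whisker_right := fun {C D E} F G α H => by
        refine eq_eqToHom_comp_comp (K := intObj C ⟶ intObj E)
          (show intMap (F.comp H) = (intMap F).comp (intMap H) from rfl)
          (show intMap (G.comp H) = (intMap G).comp (intMap H) from rfl) ?_
        exact heq_of_eq (NatTrans.ext (by funext x; rfl))
      map₂_left_unitor := fun {C E} F => by
        refine eq_eqToHom_comp (K := intObj C ⟶ intObj E) (c := intMap F)
          (show intMap ((WFunctor.id C).comp F) = (Hom.id _).comp (intMap F) from rfl) ?_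
        exact heq_of_eq (NatTrans.ext (by funext x; rfl))
      map₂_right_unitor := fun {C E} F => by
        refine eq_eqToHom_comp (K := intObj C ⟶ intObj E) (c := intMap F)
          (show intMap (F.comp (WFunctor.id E)) = (intMap F).comp (Hom.id _) from rfl) ?_
        exact heq_of_eq (NatTrans.ext (by funext x; rfl))
      map₂_associator := fun {C D D' E} F G H => by
        refine eq_eqToHom_comp_comp (K := intObj C ⟶ intObj E)
          (show intMap ((F.comp G).comp H) = ((intMap F).comp (intMap G)).comp (intMap H) from rfl)
          (show intMap (F.comp (G.comp H)) = (intMap F).comp ((intMap G).comp (intMap H)) from rfl)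
          ?_
        exact heq_of_eq (NatTrans.ext (by funext x; rfl)) }

/-- The unit `C ⟶ Γ(∫ C)`, given on objects by `X ↦ ι_X` and by identities on hom-objects. -/
def eta (C : LexProfCat.{v}) : C ⟶ Gamma.obj (Integral.obj C) :=
  ({ obj := fun X => ⟨iota C X, iota_mem C X⟩
     map := fun {A B} X Y =>
      ({ app := fun f => f
         app_left := fun f m => (elId_elComp f m).symm
         app_right := fun g m => (elComp_elId m g).symm } :
        ProfHom (C.hom X Y)
          (homProf (C := intObj C) (iota C X) (iota C Y) (iota_lex C Y)))
     map_ident := fun X => rfl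
     map_comp := fun X Y Z => Prof.comp_hom_ext fun f g => rfl } :
    WFunctor C (gammaObj (intObj C)))

end ParFL

/-! ## Biequivalences -/

namespace CategoryTheory

open scoped Pseudofunctor.StrongTrans

universe w₁ w₂ v₁ v₂ u₁ u₂

/-- A pseudofunctor is a biequivalence if it has a pseudo-inverse: a pseudofunctor in the opposite
direction such that both composites are equivalent to the identity in the bicategory of
pseudofunctors, pseudonatural transformations and modifications. -/
def Pseudofunctor.IsBiequivalence {B : Type u₁} [Bicategory.{w₁, v₁} B] {C : Type u₂}
    [Bicategory.{w₂, v₂} C] (F : B ⥤ᵖ C) : Prop :=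
  ∃ G : C ⥤ᵖ B, Nonempty (F.comp G ≌ Pseudofunctor.id B) ∧
    Nonempty (G.comp F ≌ Pseudofunctor.id C)

/-- The full and locally full sub-bicategory on the objects with a given property. -/
abbrev Bicategory.FullSub {C : Type u₂} [Bicategory.{w₂, v₂} C] (P : C → Prop) :
    Type u₂ :=
  InducedBicategory C (Subtype.val : { c // P c } → C)

/-- A pseudofunctor with values in the full and locally full sub-bicategory. -/
def Pseudofunctor.liftFullSub {B : Type u₁} [Bicategory.{w₁, v₁} B] {C : Type u₂}
    [Bicategory.{w₂, v₂} C] (F : B ⥤ᵖ C) (P : C → Prop) (h : ∀ b, P (F.obj b)) :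
    B ⥤ᵖ Bicategory.FullSub P where
  obj b := (⟨F.obj b, h b⟩ : { c // P c })
  map f := InducedBicategory.mkHom (F.map f)
  map₂ α := InducedBicategory.mkHom₂ (F.map₂ α)
  mapId b := InducedBicategory.isoMk (F.mapId b)
  mapComp f g := InducedBicategory.isoMk (F.mapComp f g)

end CategoryTheory

namespace ParFL

open LexProf

section

variable {C D : LexProfCat.{v}}

/-- A `LexProf`-functor from its action on elements of hom-objects. -/
def wFunctorMk (obj : ∀ {A : LexProf.{v}}, C.Obj A → D.Obj A)
    (map : ∀ {A B : LexProf.{v}} {X : C.Obj A} {Y : C.Obj B} {i : A} {j : B},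
      el C X Y i j → el D (obj X) (obj Y) i j)
    (map_elId : ∀ {A : LexProf.{v}} {X : C.Obj A} {i j : A} (φ : i ⟶ j),
      map (elId C X φ) = elId D (obj X) φ)
    (map_elComp : ∀ {A B K : LexProf.{v}} {X : C.Obj A} {Y : C.Obj B} {Z : C.Obj K} {i : A} {j : B}
      {k : K} (f : el C X Y i j) (g : el C Y Z j k),
      map (elComp f g) = elComp (map f) (map g)) : WFunctor C D where
  obj := obj
  map {A B} X Y :=
    ({ app := fun f => map (X := X) (Y := Y) f
       app_left := fun {i i' j} f (m : el C X Y i j) =>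
        (congrArg map (elId_elComp (C := C) f m)).symm.trans
          ((map_elComp (elId C X f) m).trans
            ((congrArg (fun t => elComp t (map m)) (map_elId f)).trans
              (elId_elComp (C := D) f (map m))))
       app_right := fun {i j j'} g (m : el C X Y i j) =>
        (congrArg map (elComp_elId (C := C) m g)).symm.trans
          ((map_elComp m (elId C Y g)).trans
            ((congrArg (elComp (map m)) (map_elId g)).trans
              (elComp_elId (C := D) (map m) g))) } : ProfHom (C.hom X Y) (D.hom (obj X) (obj Y)))
  map_ident X := ProfHom.ext (by funext i j φ; exact map_elId φ)
  map_comp X Y Z := Prof.comp_hom_ext fun f g => map_elComp f g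

/-- A map of hom-objects respects the actions, so a map out of an identity profunctor is determined
by its values at identities. -/
theorem app_eq_elComp_elId {A : LexProf.{v}} {X Y : C.Obj A} (σ : 𝟙 A ⟶ C.hom X Y) {i j : A}
    (φ : i ⟶ j) :
    ProfHom.app (M := Prof.ident A) (N := C.hom X Y) σ φ =
      elComp (ProfHom.app (M := Prof.ident A) (N := C.hom X Y) σ (𝟙 i)) (elId C Y φ) :=
  (congrArg (ProfHom.app (M := Prof.ident A) (N := C.hom X Y) σ) (Category.id_comp φ).symm).trans
    ((ProfHom.app_right (M := Prof.ident A) (N := C.hom X Y) σ φ (𝟙 i)).trans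
      (elComp_elId (C := C) (X := X) (Y := Y) (ProfHom.app (M := Prof.ident A) (N := C.hom X Y)
        σ (𝟙 i)) φ).symm)

variable {F G H : WFunctor C D}

theorem intMap₂_injective {α β : WTrans F G} (h : intMap₂ α = intMap₂ β) : α = β :=
  wtrans_ext fun {A} X {i j} φ => by
    have h' : elApp α X i = elApp β X i := congr_app h ⟨A, X, i⟩
    refine (app_eq_elComp_elId (α.app X) φ).trans
      (Eq.trans ?_ (app_eq_elComp_elId (β.app X) φ).symm)
    exact congrArg (fun t => elComp t (elId D (G.obj X) φ)) h'

/-- The component of a natural transformation as an element of a hom-object. -/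
def natEl (α : intFunctor F ⟶ intFunctor G) {A : LexProf.{v}} (X : C.Obj A) (i : A) :
    el D (F.obj X) (G.obj X) i i :=
  α.app ⟨A, X, i⟩

theorem natEl_naturality (α : intFunctor F ⟶ intFunctor G) {A B : LexProf.{v}} {X : C.Obj A}
    {Y : C.Obj B} {i : A} {j : B} (f : el C X Y i j) :
    elComp (elMap F f) (natEl α Y j) = elComp (natEl α X i) (elMap G f) :=
  α.naturality (X := ⟨A, X, i⟩) (Y := ⟨B, Y, j⟩) f

theorem natEl_elId (α : intFunctor F ⟶ intFunctor G) {A : LexProf.{v}} {X : C.Obj A} {i j : A}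
    (φ : i ⟶ j) :
    elComp (elId D (F.obj X) φ) (natEl α X j) = elComp (natEl α X i) (elId D (G.obj X) φ) := by
  have h := natEl_naturality α (elId C X φ)
  rwa [elMap_elId, elMap_elId] at h

theorem elId_comp {A : LexProf.{v}} (X : C.Obj A) {i j k : A} (φ : i ⟶ j) (ψ : j ⟶ k) :
    elId C X (φ ≫ ψ) = elComp (elId C X φ) (elId C X ψ) :=
  (iota C X).map_comp φ ψ

theorem elComp_elId_id {A B : LexProf.{v}} {X : C.Obj A} {Y : C.Obj B} {i : A} {j : B}
    (f : el C X Y i j) : elComp f (elId C Y (𝟙 j)) = f :=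
  (elComp_elId f _).trans (Profunctor.right_id _ f)

theorem elId_id_elComp {A B : LexProf.{v}} {X : C.Obj A} {Y : C.Obj B} {i : A} {j : B}
    (f : el C X Y i j) : elComp (elId C X (𝟙 i)) f = f :=
  (elId_elComp _ f).trans (Profunctor.left_id _ f)

/-- The map out of an identity profunctor given by a natural family of elements. -/
def homOfNatural {A : LexProf.{v}} {X Y : C.Obj A} (t : ∀ i : A, el C X Y i i)
    (ht : ∀ {i j : A} (φ : i ⟶ j), elComp (elId C X φ) (t j) = elComp (t i) (elId C Y φ)) :
    𝟙 A ⟶ C.hom X Y :=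
  ({ app := fun {i j} (φ : i ⟶ j) => elComp (t i) (elId C Y φ)
     app_left := fun {i i' j} φ (ψ : i ⟶ j) =>
      Eq.trans (b := elComp (elId C X φ) (elComp (t i) (elId C Y ψ)))
        (by
          rw [← elComp_assoc, ht, elComp_assoc, ← elId_comp]
          rfl)
        (elId_elComp (C := C) φ _)
     app_right := fun {i j j'} g (φ : i ⟶ j) =>
      Eq.trans (b := elComp (elComp (t i) (elId C Y φ)) (elId C Y g))
        (by
          rw [elComp_assoc, ← elId_comp]
          rfl)
        (elComp_elId (C := C) _ g) } : ProfHom (Prof.ident A) (C.hom X Y))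

/-- A `LexProf`-transformation from a natural transformation. -/
def wTransMk (α : intFunctor F ⟶ intFunctor G) : WTrans F G where
  app X := homOfNatural (natEl α X) (natEl_elId α)
  naturality {A B} X Y := ProfHom.ext (by
    funext i j f
    have h := natEl_naturality α (X := X) (Y := Y) f
    rw [← elComp_elId_id (natEl α Y j), ← elComp_elId_id (natEl α X i)] at h
    exact h)

theorem intMap₂_wTransMk (α : intFunctor F ⟶ intFunctor G) : intMap₂ (wTransMk α) = α :=
  NatTrans.ext (by funext x; exact Category.comp_id (α.app x))

theorem intMap₂_comp (α : WTrans F G) (β : WTrans G H) :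
    intMap₂ (WTrans.vcomp α β) = intMap₂ α ≫ intMap₂ β := rfl

/-- An isomorphism of `LexProf`-functors from a natural isomorphism. -/
def wIsoMk {F G : C ⟶ D} (e : intFunctor F ≅ intFunctor G) : F ≅ G where
  hom := wTransMk e.hom
  inv := wTransMk e.inv
  hom_inv_id := intMap₂_injective (F := F) (G := F) (by
    refine (intMap₂_comp (wTransMk e.hom) (wTransMk e.inv)).trans ?_
    rw [intMap₂_wTransMk, intMap₂_wTransMk, e.hom_inv_id]
    rfl)
  inv_hom_id := intMap₂_injective (F := G) (G := G) (by
    refine (intMap₂_comp (wTransMk e.inv) (wTransMk e.hom)).trans ?_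
    rw [intMap₂_wTransMk, intMap₂_wTransMk, e.inv_hom_id]
    rfl)

end

/-! ## The counit -/

/-- The functor `∫ Γ(D) ⥤ D` sending `(X, i)` to `X i`. -/
def eps (D : ParFL.{v}) : IntObj (gammaObj D) ⥤ D where
  obj x := x.pt.1.obj x.elt
  map f := f
  map_id x := x.pt.1.map_id x.elt
  map_comp f g := rfl

theorem eps_mem (D : ParFL.{v}) {A : LexProf.{v}} {G : A ⥤ IntObj (gammaObj D)}
    (hG : G ∈ (intObj (gammaObj D)).sieve.mem A) : G ⋙ eps D ∈ D.sieve.mem A := by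
  obtain ⟨B, Y, H, hH, ⟨e⟩⟩ := hG
  exact D.sieve.iso_mem (D.sieve.comp_mem Y.2 H hH) (Functor.isoWhiskerRight e (eps D)).symm

/-- The counit `∫ Γ(D) ⟶ D`. -/
def epsHom (D : ParFL.{v}) : Hom (intObj (gammaObj D)) D where
  functor := eps D
  comp_mem := eps_mem D

section

variable {C : LexProfCat.{v}} {D : ParFL.{v}}

/-- The transpose of a `LexProf`-functor into `Γ(D)`. -/
def transpose (S : WFunctor C (gammaObj D)) : IntObj C ⥤ D := intFunctor S ⋙ eps D

theorem transpose_map_elId (S : WFunctor C (gammaObj D)) {A : LexProf.{v}} (X : C.Obj A) {i j : A}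
    (φ : i ⟶ j) :
    (transpose S).map (X := ⟨A, X, i⟩) (Y := ⟨A, X, j⟩) (elId C X φ) = (S.obj X).1.map φ :=
  elMap_elId S φ

theorem transpose_injective {S T : WFunctor C (gammaObj D)} (h : transpose S = transpose T) :
    S = T := by
  have hobj : @WFunctor.obj _ _ _ _ S = @WFunctor.obj _ _ _ _ T := by
    funext A X
    refine Subtype.ext (CategoryTheory.Functor.hext
      (fun i => congrArg (fun K => K.obj (⟨A, X, i⟩ : IntObj C)) h) fun i j φ => ?_)
    exact (heq_of_eq (transpose_map_elId S X φ).symm).trans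
      ((CategoryTheory.Functor.hcongr_hom h (X := ⟨A, X, i⟩) (Y := ⟨A, X, j⟩) (elId C X φ)).trans
        (heq_of_eq (transpose_map_elId T X φ)))
  refine WFunctor.ext hobj ?_
  have hmap : ∀ {A B : LexProf.{v}} (X : C.Obj A) (Y : C.Obj B) {i : A} {j : B}
      (f : el C X Y i j), HEq (elMap S f) (elMap T f) := fun {A B} X Y {i j} f =>
    CategoryTheory.Functor.hcongr_hom h (X := ⟨A, X, i⟩) (Y := ⟨B, Y, j⟩) f
  obtain ⟨So, Sm, h1, h2⟩ := S
  obtain ⟨To, Tm, h3, h4⟩ := T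
  dsimp only at hobj
  subst hobj
  apply heq_of_eq
  funext A B X Y
  apply ProfHom.ext
  funext i j f
  exact eq_of_heq (hmap X Y f)

/-- The transpose of a `LexProf`-transformation. -/
def transpose₂ {S T : WFunctor C (gammaObj D)} (α : WTrans S T) : transpose S ⟶ transpose T :=
  Functor.whiskerRight (intMap₂ α) (eps D)

theorem transpose₂_injective {S T : WFunctor C (gammaObj D)} {α β : WTrans S T}
    (h : transpose₂ α = transpose₂ β) : α = β :=
  intMap₂_injective (NatTrans.ext (by funext x; exact congr_app h x))

theorem heq_of_transpose₂ {S S' T T' : WFunctor C (gammaObj D)} (hS : S = S') (hT : T = T')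
    {α : WTrans S T} {β : WTrans S' T'}
    (h : ∀ x, HEq ((transpose₂ α).app x) ((transpose₂ β).app x)) : HEq α β := by
  subst hS hT
  exact heq_of_eq (transpose₂_injective (NatTrans.ext (by funext x; exact eq_of_heq (h x))))

theorem transpose_mem (S : WFunctor C (gammaObj D)) {A : LexProf.{v}} {G : A ⥤ IntObj C}
    (hG : G ∈ (intObj C).sieve.mem A) : G ⋙ transpose S ∈ D.sieve.mem A :=
  eps_mem D ((intMap S).comp_mem hG)

end

theorem eta_naturality {C D : LexProfCat.{v}} (F : C ⟶ D) :
    eta C ≫ Gamma.map (Integral.map F) = F ≫ eta D :=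
  transpose_injective (S := WFunctor.comp (eta C) (gammaMap (intMap F)))
    (T := WFunctor.comp F (eta D)) rfl

theorem eta_naturality₂ {C D : LexProfCat.{v}} {F G : C ⟶ D} (α : F ⟶ G) :
    HEq (eta C ◁ Gamma.map₂ (Integral.map₂ α)) (α ▷ eta D) := by
  refine heq_of_transpose₂ (D := intObj D) (eta_naturality F) (eta_naturality G)
    (α := eta C ◁ Gamma.map₂ (Integral.map₂ α)) (β := α ▷ eta D) fun x => heq_of_eq ?_
  have h : elComp (elApp α x.pt x.elt) (elMap G (elId C x.pt (𝟙 x.elt))) =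
      elApp α x.pt x.elt := by
    rw [elMap_elId]
    exact elComp_elId_id _
  exact h

theorem eta_comp_bijective (C : LexProfCat.{v}) (D : ParFL.{v}) :
    Function.Bijective fun F : Integral.obj C ⟶ D => eta C ≫ Gamma.map F := by
  constructor
  · intro F G h
    have h' : F.functor = G.functor := congrArg (transpose (C := C) (D := D)) h
    obtain ⟨F, _⟩ := F
    obtain ⟨G, _⟩ := G
    dsimp only at h'
    subst h'
    rfl
  · intro S
    exact ⟨(⟨transpose S, transpose_mem S⟩ : Hom (intObj C) D), transpose_injective rfl⟩

theorem transpose₂_eta_whiskerLeft {C : LexProfCat.{v}} {D : ParFL.{v}} {F G : Hom (intObj C) D}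
    (α : F.functor ⟶ G.functor) :
    transpose₂ (WTrans.whiskerLeft (eta C) (gammaMap₂ α)) = α :=
  NatTrans.ext (by
    funext x
    exact (congrArg (α.app x ≫ ·) (G.functor.map_id x)).trans (Category.comp_id _))

theorem eta_comp_isEquivalence (C : LexProfCat.{v}) (D : ParFL.{v}) :
    (Gamma.mapFunctor (Integral.obj C) D ⋙ precomp (Gamma.obj D) (eta C)).IsEquivalence where
  faithful := ⟨fun {F G} α β h => by
    have h' := congrArg (transpose₂ (C := C) (D := D)) h
    exact (transpose₂_eta_whiskerLeft (F := F) (G := G) α).symm.trans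
      (Eq.trans h' (transpose₂_eta_whiskerLeft (F := F) (G := G) β))⟩
  full := ⟨fun {F G} θ => ⟨transpose₂ (C := C) (D := D) θ, transpose₂_injective
    (transpose₂_eta_whiskerLeft (F := F) (G := G) _)⟩⟩
  essSurj := ⟨fun S => by
    obtain ⟨F, hF⟩ := (eta_comp_bijective C D).2 S
    exact ⟨F, ⟨eqToIso hF⟩⟩⟩

end ParFL

namespace ParFL

open LexProf

/-! ## Equivalences of `LexProf`-categories -/

section

variable {C D : LexProfCat.{v}}

/-- An isomorphism in `∫ C` from mutually inverse elements. -/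
def elIso {A B : LexProf.{v}} {X : C.Obj A} {Y : C.Obj B} {i : A} {j : B} (f : el C X Y i j)
    (g : el C Y X j i) (hfg : elComp f g = elId C X (𝟙 i)) (hgf : elComp g f = elId C Y (𝟙 j)) :
    (⟨A, X, i⟩ : IntObj C) ≅ ⟨B, Y, j⟩ where
  hom := f
  inv := g
  hom_inv_id := hfg
  inv_hom_id := hgf

/-- A fully faithful and essentially surjective `LexProf`-functor, with chosen essential
preimages. -/
structure SplitEquivalence (F : WFunctor C D) where
  bij : ∀ {A B : LexProf.{v}} (X : C.Obj A) (Y : C.Obj B) (i : A) (j : B),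
    Function.Bijective fun f : el C X Y i j => elMap F f
  /-- The chosen essential preimage. -/
  pre : ∀ {A : LexProf.{v}}, D.Obj A → C.Obj A
  /-- The image of the preimage is isomorphic to the given object. -/
  iso : ∀ {A : LexProf.{v}} (Z : D.Obj A), iota D (F.obj (pre Z)) ≅ iota D Z

namespace SplitEquivalence

variable {F : WFunctor C D} (h : SplitEquivalence F) {A B K : LexProf.{v}}

/-- The element underlying the isomorphism. -/
def forth (Z : D.Obj A) (i : A) : el D (F.obj (h.pre Z)) Z i i := (h.iso Z).hom.app i

/-- The element underlying the inverse isomorphism. -/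
def back (Z : D.Obj A) (i : A) : el D Z (F.obj (h.pre Z)) i i := (h.iso Z).inv.app i

theorem forth_back (Z : D.Obj A) (i : A) :
    elComp (h.forth Z i) (h.back Z i) = elId D (F.obj (h.pre Z)) (𝟙 i) :=
  (h.iso Z).hom_inv_id_app i

theorem back_forth (Z : D.Obj A) (i : A) :
    elComp (h.back Z i) (h.forth Z i) = elId D Z (𝟙 i) :=
  (h.iso Z).inv_hom_id_app i

theorem back_naturality (Z : D.Obj A) {i j : A} (φ : i ⟶ j) :
    elComp (elId D Z φ) (h.back Z j) = elComp (h.back Z i) (elId D (F.obj (h.pre Z)) φ) :=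
  (h.iso Z).inv.naturality φ

/-- The inverse of the action on elements. -/
noncomputable def elInv {X : C.Obj A} {Y : C.Obj B} {i : A} {j : B}
    (f : el D (F.obj X) (F.obj Y) i j) : el C X Y i j :=
  (h.bij X Y i j).2 f |>.choose

theorem elMap_elInv {X : C.Obj A} {Y : C.Obj B} {i : A} {j : B}
    (f : el D (F.obj X) (F.obj Y) i j) : elMap F (h.elInv f) = f :=
  (h.bij X Y i j).2 f |>.choose_spec

theorem elMap_inj (h : SplitEquivalence F) {X : C.Obj A} {Y : C.Obj B} {i : A} {j : B}
    {f g : el C X Y i j}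
    (e : elMap F f = elMap F g) : f = g :=
  (h.bij X Y i j).1 e

theorem back_forth_elComp {X : D.Obj B} (Z : D.Obj A) {i : A} {j : B} (f : el D Z X i j) :
    elComp (h.back Z i) (elComp (h.forth Z i) f) = f := by
  rw [← elComp_assoc, back_forth, elId_id_elComp]

theorem forth_back_elComp {X : D.Obj B} (Z : D.Obj A) {i : A} {j : B}
    (f : el D (F.obj (h.pre Z)) X i j) :
    elComp (h.forth Z i) (elComp (h.back Z i) f) = f := by
  rw [← elComp_assoc, forth_back, elId_id_elComp]

/-- The inverse `LexProf`-functor. -/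
noncomputable def inverse : WFunctor D C :=
  wFunctorMk h.pre (fun {A B Z Z' i j} f => h.elInv (elComp (h.forth Z i) (elComp f (h.back Z' j))))
    (fun {A Z i j} φ => h.elMap_inj (by
      rw [elMap_elInv, elMap_elId, h.back_naturality, h.forth_back_elComp]))
    (fun {A B K Z Z' Z'' i j k} f g => h.elMap_inj (by
      rw [elMap_elInv, elMap_elComp, elMap_elInv, elMap_elInv]
      simp only [elComp_assoc]
      rw [h.back_forth_elComp]))

theorem elMap_inverse {Z : D.Obj A} {Z' : D.Obj B} {i : A} {j : B} (f : el D Z Z' i j) :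
    elMap F (elMap h.inverse f) = elComp (h.forth Z i) (elComp f (h.back Z' j)) :=
  h.elMap_elInv _

theorem elInv_back_forth (X : C.Obj A) (i : A) :
    elComp (h.elInv (h.back (F.obj X) i)) (h.elInv (h.forth (F.obj X) i)) = elId C X (𝟙 i) :=
  h.elMap_inj (by rw [elMap_elComp, elMap_elInv, elMap_elInv, back_forth, elMap_elId])

theorem elInv_forth_back (X : C.Obj A) (i : A) :
    elComp (h.elInv (h.forth (F.obj X) i)) (h.elInv (h.back (F.obj X) i)) =
      elId C (h.pre (F.obj X)) (𝟙 i) :=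
  h.elMap_inj (by rw [elMap_elComp, elMap_elInv, elMap_elInv, forth_back, elMap_elId])

theorem elInv_back_naturality {X : C.Obj A} {Y : C.Obj B} {i : A} {j : B} (f : el C X Y i j) :
    elComp f (h.elInv (h.back (F.obj Y) j)) = elComp (h.elInv (h.back (F.obj X) i))
      (h.elInv (elComp (h.forth (F.obj X) i) (elComp (elMap F f) (h.back (F.obj Y) j)))) :=
  h.elMap_inj (by
    rw [elMap_elComp, elMap_elComp, elMap_elInv, elMap_elInv, elMap_elInv, back_forth_elComp])

theorem forth_naturality {Z : D.Obj A} {Z' : D.Obj B} {i : A} {j : B} (f : el D Z Z' i j) :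
    elComp (elComp (h.forth Z i) (elComp f (h.back Z' j))) (h.forth Z' j) =
      elComp (h.forth Z i) f := by
  rw [elComp_assoc, elComp_assoc, back_forth, elComp_elId_id]

/-- The unit. -/
noncomputable def unit : (𝟙 C : C ⟶ C) ≅ (show C ⟶ D from F) ≫ (show D ⟶ C from h.inverse) :=
  wIsoMk (NatIso.ofComponents
    (fun x => elIso (h.elInv (h.back (F.obj x.pt) x.elt)) (h.elInv (h.forth (F.obj x.pt) x.elt))
      (h.elInv_back_forth _ _) (h.elInv_forth_back _ _))
    (fun {x y} f => h.elInv_back_naturality (X := x.pt) (Y := y.pt) f))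

/-- The counit. -/
noncomputable def counit : (show D ⟶ C from h.inverse) ≫ (show C ⟶ D from F) ≅ (𝟙 D : D ⟶ D) :=
  wIsoMk (NatIso.ofComponents
    (fun x => elIso (h.forth x.pt x.elt) (h.back x.pt x.elt) (h.forth_back _ _) (h.back_forth _ _))
    (fun {x y} f => (congrArg (fun t => elComp t (h.forth y.pt y.elt))
      (h.elMap_inverse (Z := x.pt) (Z' := y.pt) f)).trans
        (h.forth_naturality (Z := x.pt) (Z' := y.pt) f)))

/-- The equivalence in the 2-category of `LexProf`-categories. -/
noncomputable def equivalence : C ≌ D :=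
  Bicategory.Equivalence.mkOfAdjointifyCounit h.unit h.counit

end SplitEquivalence

end

/-! ## The counit is an equivalence, and `Γ` is an equivalence on hom-categories -/

instance (D : ParFL.{v}) : (eps D).Faithful := ⟨fun h => h⟩

instance (D : ParFL.{v}) : (eps D).Full := ⟨fun f => ⟨f, rfl⟩⟩

instance (D : ParFL.{v}) : (eps D).EssSurj := ⟨fun c => by
  obtain ⟨A, X, hX, i, hi⟩ := D.sieve.cover c
  exact ⟨⟨A, ⟨X, hX⟩, i⟩, ⟨eqToIso hi⟩⟩⟩

instance (D : ParFL.{v}) : (eps D).IsEquivalence where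

theorem eps_inv_mem (D : ParFL.{v}) {A : LexProf.{v}} {X : A ⥤ D} (hX : X ∈ D.sieve.mem A) :
    X ⋙ (eps D).inv ∈ (intObj (gammaObj D)).sieve.mem A := by
  let Y : (gammaObj D).Obj A := ⟨X, hX⟩
  have e : iota (gammaObj D) Y ⋙ eps D ≅ X :=
    NatIso.ofComponents (fun i => Iso.refl _)
      (fun f => (Category.comp_id _).trans (Category.id_comp _).symm)
  exact (intObj (gammaObj D)).sieve.iso_mem (iota_mem (gammaObj D) Y)
    (Functor.isoWhiskerLeft (iota (gammaObj D) Y) (eps D).asEquivalence.unitIso ≪≫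
      Functor.isoWhiskerRight e (eps D).inv)

/-- The inverse of the counit. -/
noncomputable def epsInv (D : ParFL.{v}) : Hom D (intObj (gammaObj D)) where
  functor := (eps D).inv
  comp_mem := eps_inv_mem D

/-- The counit as an equivalence in the 2-category of partially finitely complete categories. -/
noncomputable def epsEquivalence (D : ParFL.{v}) :
    Bicategory.Equivalence (intObj (gammaObj D)) D :=
  Bicategory.Equivalence.mkOfAdjointifyCounit
    (f := (epsHom D : intObj (gammaObj D) ⟶ D)) (g := (epsInv D : D ⟶ intObj (gammaObj D)))
    (show 𝟙 (intObj (gammaObj D)) ≅ (epsHom D : intObj (gammaObj D) ⟶ D) ≫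
        (epsInv D : D ⟶ intObj (gammaObj D)) from
      Hom.isoMk (F := Hom.id _) (G := (epsHom D).comp (epsInv D)) (eps D).asEquivalence.unitIso)
    (show (epsInv D : D ⟶ intObj (gammaObj D)) ≫ (epsHom D : intObj (gammaObj D) ⟶ D) ≅ 𝟙 D from
      Hom.isoMk (F := (epsInv D).comp (epsHom D)) (G := Hom.id _)
        (eps D).asEquivalence.counitIso)

/-- An isomorphism of `LexProf`-functors into `Γ(D)` from an isomorphism of transposes. -/
noncomputable def isoOfTranspose {C : LexProfCat.{v}} {D : ParFL.{v}} {S T : C ⟶ gammaObj D}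
    (e : transpose S ≅ transpose T) : S ≅ T :=
  wIsoMk (((Functor.FullyFaithful.ofFullyFaithful (eps D)).whiskeringRight
    (IntObj C)).preimageIso e)

theorem transpose₂_gammaMap₂ {C D : ParFL.{v}} {F G : Hom C D} (α : F.functor ⟶ G.functor) :
    transpose₂ (gammaMap₂ α) = Functor.whiskerLeft (eps C) α :=
  NatTrans.ext (by
    funext x
    refine (congrArg (α.app (x.pt.1.obj x.elt) ≫ ·)
      ((congrArg G.functor.map (x.pt.1.map_id x.elt)).trans (G.functor.map_id _))).trans ?_
    exact Category.comp_id _)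

theorem gamma_mapFunctor_isEquivalence (C D : ParFL.{v}) :
    (Gamma.mapFunctor C D).IsEquivalence where
  faithful := ⟨fun {F G} α β h => by
    have h' := congrArg (transpose₂ (C := gammaObj C) (D := D)) h
    exact ((Functor.whiskeringLeft _ _ D).obj (eps C)).map_injective
      ((transpose₂_gammaMap₂ (F := F) (G := G) α).symm.trans
        (Eq.trans h' (transpose₂_gammaMap₂ (F := F) (G := G) β)))⟩
  full := ⟨fun {F G} θ => by
    obtain ⟨α, hα⟩ := ((Functor.whiskeringLeft _ _ D).obj (eps C)).map_surjective
      (X := F.functor) (Y := G.functor) (transpose₂ (C := gammaObj C) (D := D) θ)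
    exact ⟨α, transpose₂_injective ((transpose₂_gammaMap₂ (F := F) (G := G) α).trans hα)⟩⟩
  essSurj := ⟨fun S => by
    let F : Hom C D := (epsInv C).comp ⟨transpose S, transpose_mem S⟩
    exact ⟨F, ⟨isoOfTranspose (S := gammaMap F) (T := S)
      (show eps C ⋙ (eps C).inv ⋙ transpose S ≅ transpose S from
        (Functor.associator _ _ _).symm ≪≫
        Functor.isoWhiskerRight (eps C).asEquivalence.unitIso.symm (transpose S) ≪≫
        Functor.leftUnitor _)⟩⟩⟩

end ParFL

namespace ParFL

open LexProf

/-! ## Tensors by representable weights -/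

section

variable {A B K : LexProf.{v}}

/-- The lex profunctor `A(-, F-)`. -/
def weight (F : B ⥤ A) (hF : PreservesFiniteLimits F) : Prof A B where
  obj a b := a ⟶ F.obj b
  left f m := f ≫ m
  right g m := m ≫ F.map g
  left_id m := Category.id_comp m
  left_comp f g m := Category.assoc f g m
  right_id m := by simp
  right_comp f g m := by simp
  left_right f g m := (Category.assoc f m _).symm
  lex a := (inferInstance : PreservesFiniteLimits (F ⋙ coyoneda.obj (op a)))

/-- The lex profunctor `A(F-, -)`. -/
def coweight (F : B ⥤ A) : Prof B A where
  obj b a := F.obj b ⟶ a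
  left g m := F.map g ≫ m
  right f m := m ≫ f
  left_id m := by simp
  left_comp f g m := by simp
  right_id m := Category.comp_id m
  right_comp f g m := (Category.assoc m f g).symm
  left_right f g m := (Category.assoc _ m g).symm
  lex b := (inferInstance : PreservesFiniteLimits (coyoneda.obj (op (F.obj b))))

variable {C D : LexProfCat.{v}} {X : C.Obj A} {Y : C.Obj B} {Z : C.Obj K}

/-- The value of a map of lex profunctors into a hom-object. -/
def homApp {M : Prof A B} (σ : (show A ⟶ B from M) ⟶ C.hom X Y) {a : A} {b : B} (m : M.obj a b) :
    el C X Y a b :=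
  ProfHom.app (M := M) (N := C.hom X Y) σ m

theorem homApp_left {M : Prof A B} (σ : (show A ⟶ B from M) ⟶ C.hom X Y) {a a' : A} {b : B}
    (f : a' ⟶ a) (m : M.obj a b) :
    homApp σ (M.left f m) = elComp (elId C X f) (homApp σ m) :=
  (ProfHom.app_left (M := M) (N := C.hom X Y) σ f m).trans (elId_elComp f _).symm

theorem homApp_right {M : Prof A B} (σ : (show A ⟶ B from M) ⟶ C.hom X Y) {a : A} {b b' : B}
    (g : b ⟶ b') (m : M.obj a b) :
    homApp σ (M.right g m) = elComp (homApp σ m) (elId C Y g) :=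
  (ProfHom.app_right (M := M) (N := C.hom X Y) σ g m).trans (elComp_elId _ g).symm

/-- A map into a hom-object from its values. -/
def homOfEl {M : Prof A B} (σ : ∀ {a : A} {b : B}, M.obj a b → el C X Y a b)
    (hl : ∀ {a a' : A} {b : B} (f : a' ⟶ a) (m : M.obj a b),
      σ (M.left f m) = elComp (elId C X f) (σ m))
    (hr : ∀ {a : A} {b b' : B} (g : b ⟶ b') (m : M.obj a b),
      σ (M.right g m) = elComp (σ m) (elId C Y g)) :
    (show A ⟶ B from M) ⟶ C.hom X Y :=
  ({ app := σ
     app_left := fun f m => (hl f m).trans (elId_elComp f _)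
     app_right := fun g m => (hr g m).trans (elComp_elId _ g) } : ProfHom M (C.hom X Y))

theorem homApp_ext {M : Prof A B} {σ τ : (show A ⟶ B from M) ⟶ C.hom X Y}
    (h : ∀ {a : A} {b : B} (m : M.obj a b), homApp σ m = homApp τ m) : σ = τ :=
  ProfHom.ext (by funext a b m; exact h m)

variable {F : B ⥤ A} {hF : PreservesFiniteLimits F}

/-- The universal elements of a map out of the weight `A(-, F-)`. -/
def unitEl (u : (show A ⟶ B from weight F hF) ⟶ C.hom X Y) (b : B) : el C X Y (F.obj b) b :=
  homApp (M := weight F hF) u (𝟙 (F.obj b))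

theorem homApp_weight (u : (show A ⟶ B from weight F hF) ⟶ C.hom X Y) {a : A} {b : B}
    (m : a ⟶ F.obj b) :
    homApp (M := weight F hF) u m = elComp (elId C X m) (unitEl u b) :=
  (congrArg (homApp (M := weight F hF) u) (Category.comp_id m).symm).trans
    (homApp_left (M := weight F hF) u m (𝟙 (F.obj b)))

theorem unitEl_naturality (u : (show A ⟶ B from weight F hF) ⟶ C.hom X Y) {b b' : B}
    (β : b ⟶ b') :
    elComp (unitEl u b) (elId C Y β) = elComp (elId C X (F.map β)) (unitEl u b') :=
  (homApp_right (M := weight F hF) u β (𝟙 (F.obj b))).symm.trans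
    ((congrArg (homApp (M := weight F hF) u) (Category.id_comp (F.map β))).trans
      (homApp_weight u (F.map β)))

theorem inverse_naturality (u : (show A ⟶ B from weight F hF) ⟶ C.hom X Y)
    (w : ∀ b, el C Y X b (F.obj b)) (h₁ : ∀ b, elComp (unitEl u b) (w b) = elId C X (𝟙 _))
    (h₂ : ∀ b, elComp (w b) (unitEl u b) = elId C Y (𝟙 b)) {b b' : B} (β : b ⟶ b') :
    elComp (w b) (elId C X (F.map β)) = elComp (elId C Y β) (w b') := by
  rw [← elComp_elId_id (elComp (w b) (elId C X (F.map β))), ← h₁, elComp_assoc,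
    ← elComp_assoc _ (unitEl u b') (w b'), ← unitEl_naturality, elComp_assoc, ← elComp_assoc (w b),
    h₂, elId_id_elComp]

theorem isTensor_of_inverse (u : (show A ⟶ B from weight F hF) ⟶ C.hom X Y)
    (w : ∀ b, el C Y X b (F.obj b)) (h₁ : ∀ b, elComp (unitEl u b) (w b) = elId C X (𝟙 _))
    (h₂ : ∀ b, elComp (w b) (unitEl u b) = elId C Y (𝟙 b)) :
    C.IsTensor (show A ⟶ B from weight F hF) X Y u := by
  intro K (U : Prof B K) Z
  constructor
  · intro f g hfg
    refine homApp_ext (M := U) fun {b c} n => ?_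
    have h := congrArg (fun σ => homApp (M := (weight F hF).comp U) σ
      (Profunctor.pair (M := (weight F hF).toProfunctor) (𝟙 (F.obj b)) n)) hfg
    replace h : elComp (unitEl u b) (homApp (M := U) f n) =
      elComp (unitEl u b) (homApp (M := U) g n) := h
    rw [← elId_id_elComp (homApp (M := U) f n), ← h₂, elComp_assoc, h, ← elComp_assoc, h₂,
      elId_id_elComp]
  · intro φ
    let φ' : ∀ {a : A} {b : B} {c : K}, (a ⟶ F.obj b) → U.obj b c → el C X Z a c :=
      fun m n => homApp (M := (weight F hF).comp U) φ
        (Profunctor.pair (M := (weight F hF).toProfunctor) m n)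
    have φ'_left : ∀ {a a' : A} {b : B} {c : K} (f : a' ⟶ a) (m : a ⟶ F.obj b)
        (n : U.obj b c), φ' (f ≫ m) n = elComp (elId C X f) (φ' m n) := fun f m n =>
      homApp_left (M := (weight F hF).comp U) φ f
        (Profunctor.pair (M := (weight F hF).toProfunctor) m n)
    have φ'_right : ∀ {a : A} {b : B} {c c' : K} (g : c ⟶ c') (m : a ⟶ F.obj b)
        (n : U.obj b c), φ' m (Profunctor.right _ g n) = elComp (φ' m n) (elId C Z g) :=
      fun g m n => homApp_right (M := (weight F hF).comp U) φ g
        (Profunctor.pair (M := (weight F hF).toProfunctor) m n)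
    have φ'_mid : ∀ {a : A} {b b' : B} {c : K} (β : b' ⟶ b) (m : a ⟶ F.obj b')
        (n : U.obj b c), φ' m (Profunctor.left _ β n) = φ' (m ≫ F.map β) n := fun β m n =>
      congrArg (homApp (M := (weight F hF).comp U) φ)
        (Profunctor.pair_right (M := (weight F hF).toProfunctor) β m n).symm
    have φ'_one : ∀ {a : A} {b : B} {c : K} (m : a ⟶ F.obj b) (n : U.obj b c),
        φ' m n = elComp (elId C X m) (φ' (𝟙 _) n) := fun m n => by
      rw [← φ'_left, Category.comp_id]
    refine ⟨homOfEl (M := U) (fun {b c} n => elComp (w b) (φ' (𝟙 _) n)) ?_ ?_, ?_⟩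
    · intro b b' c β n
      rw [φ'_mid, φ'_one, ← elComp_assoc, Category.id_comp,
        inverse_naturality u w h₁ h₂, elComp_assoc]
    · intro b c c' g n
      rw [φ'_right, elComp_assoc]
    · refine Prof.comp_hom_ext (M := weight F hF) (N := U) fun {a b c} (m : a ⟶ F.obj b) n => ?_
      change elComp (homApp (M := weight F hF) u m) (elComp (w b) (φ' (𝟙 _) n)) = φ' m n
      rw [φ'_one m n, homApp_weight, elComp_assoc, ← elComp_assoc (unitEl u b), h₁,
        elId_id_elComp]

theorem inverse_of_isTensor (u : (show A ⟶ B from weight F hF) ⟶ C.hom X Y)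
    (hu : C.IsTensor (show A ⟶ B from weight F hF) X Y u) :
    ∃ w : ∀ b, el C Y X b (F.obj b), (∀ b, elComp (unitEl u b) (w b) = elId C X (𝟙 _)) ∧
      ∀ b, elComp (w b) (unitEl u b) = elId C Y (𝟙 b) := by
  obtain ⟨f, hf⟩ := (hu (show B ⟶ A from coweight F) X).2
    (homOfEl (M := (weight F hF).comp (coweight F))
      (fun {a a'} => Profunctor.Coend.lift (fun (m : a ⟶ F.obj _) (n : F.obj _ ⟶ a') =>
        elId C X (m ≫ n)) (fun β (m : a ⟶ F.obj _) (n : F.obj _ ⟶ a') =>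
          congrArg (elId C X) (Category.assoc m (F.map β) n)))
      (fun {a a' b} f => Profunctor.Coend.ind fun (m : a ⟶ F.obj _) (n : F.obj _ ⟶ b) =>
        (congrArg (elId C X) (Category.assoc f m n)).trans (elId_comp X f (m ≫ n)))
      (fun {a b b'} g => Profunctor.Coend.ind fun (m : a ⟶ F.obj _) (n : F.obj _ ⟶ b) =>
        (congrArg (elId C X) (Category.assoc m n g).symm).trans (elId_comp X (m ≫ n) g)))
  have hf' : ∀ {a a' : A} {b : B} (m : a ⟶ F.obj b) (n : F.obj b ⟶ a'),
      elComp (homApp (M := weight F hF) u m) (homApp (M := coweight F) f n) =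
        elId C X (m ≫ n) := fun {a a' b} m n =>
    congrArg (fun σ => homApp (M := (weight F hF).comp (coweight F)) σ
      (Profunctor.pair (M := (weight F hF).toProfunctor) (N := (coweight F).toProfunctor) m n)) hf
  have h₁ : ∀ b, elComp (unitEl u b) (homApp (M := coweight F) f (𝟙 (F.obj b))) =
      elId C X (𝟙 _) := fun b => (hf' _ _).trans (congrArg (elId C X) (Category.id_comp _))
  have hfl : ∀ {b b' : B} (β : b ⟶ b'), elComp (homApp (M := coweight F) f (𝟙 (F.obj b)))
      (elId C X (F.map β)) = elComp (elId C Y β) (homApp (M := coweight F) f (𝟙 (F.obj b'))) :=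
    fun {b b'} β => (homApp_right (M := coweight F) f (F.map β) (𝟙 (F.obj b))).symm.trans
      ((congrArg (homApp (M := coweight F) f)
        ((Category.id_comp (F.map β)).trans (Category.comp_id (F.map β)).symm)).trans
          (homApp_left (M := coweight F) f β (𝟙 (F.obj b'))))
  refine ⟨fun b => homApp (M := coweight F) f (𝟙 (F.obj b)), h₁, fun b => ?_⟩
  let w : ∀ b, el C Y X b (F.obj b) := fun b => homApp (M := coweight F) f (𝟙 (F.obj b))
  have key : (homOfNatural (fun b => elComp (w b) (unitEl u b)) (fun {b b'} β => by
      rw [← elComp_assoc, ← hfl, elComp_assoc, elComp_assoc, unitEl_naturality]) :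
        𝟙 B ⟶ C.hom Y Y) = C.ident Y := by
    refine (hu (𝟙 B) Y).1 ?_
    refine Prof.comp_hom_ext (M := weight F hF) (N := Prof.ident B)
      fun {a b b'} (m : a ⟶ F.obj b) (β : b ⟶ b') => ?_
    change elComp (homApp (M := weight F hF) u m) (elComp (elComp (w b) (unitEl u b))
      (elId C Y β)) = elComp (homApp (M := weight F hF) u m) (elId C Y β)
    rw [homApp_weight, elComp_assoc, elComp_assoc (w b), ← elComp_assoc (unitEl u b), h₁,
      elId_id_elComp, elComp_assoc]
  have h := congrArg (fun σ => homApp (M := Prof.ident B) σ (𝟙 b)) key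
  exact (elComp_elId_id _).symm.trans h

theorem absoluteTensorsBy_weight (F : B ⥤ A) (hF : PreservesFiniteLimits F) :
    WCategory.AbsoluteTensorsBy.{v, v + 1, v + 1, v + 1} (show A ⟶ B from weight F hF) := by
  intro C D G X Y u hu
  obtain ⟨w, h₁, h₂⟩ := inverse_of_isTensor u hu
  refine isTensor_of_inverse (u ≫ G.map X Y) (fun b => elMap G (w b)) (fun b => ?_) fun b => ?_
  · exact (elMap_elComp G (unitEl u b) (w b)).symm.trans
      ((congrArg (elMap G) (h₁ b)).trans (elMap_elId G _))
  · exact (elMap_elComp G (w b) (unitEl u b)).symm.trans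
      ((congrArg (elMap G) (h₂ b)).trans (elMap_elId G _))

/-- `Γ(D)` admits tensors by representable weights. -/
theorem gammaObj_hasTensor_weight (D : ParFL.{v}) (F : B ⥤ A) (hF : PreservesFiniteLimits F)
    (X : (gammaObj D).Obj A) :
    ∃ (Y : (gammaObj D).Obj B) (u : (show A ⟶ B from weight F hF) ⟶ (gammaObj D).hom X Y),
      (gammaObj D).IsTensor (show A ⟶ B from weight F hF) X Y u := by
  let Y : (gammaObj D).Obj B := ⟨F ⋙ X.1, D.sieve.comp_mem X.2 F hF⟩
  let u : (show A ⟶ B from weight F hF) ⟶ (gammaObj D).hom X Y :=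
    homOfEl (M := weight F hF) (C := gammaObj D) (X := X) (Y := Y)
      (fun {a b} (m : a ⟶ F.obj b) => X.1.map m)
      (fun f m => X.1.map_comp f m) (fun g m => X.1.map_comp m (F.map g))
  refine ⟨Y, u, isTensor_of_inverse u (fun b => 𝟙 (X.1.obj (F.obj b))) (fun b => ?_) fun b => ?_⟩
  · exact Category.comp_id (X.1.map (𝟙 (F.obj b)))
  · exact (Category.id_comp (X.1.map (𝟙 (F.obj b)))).trans
      (congrArg X.1.map (F.map_id b).symm)

end

end ParFL

namespace WCategory

variable {W : Type u} [Bicategory.{w, v} W] {C : WCategory.{w, v, u, o} W}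

theorem IsTensor.of_iso {x y : W} {A A' : x ⟶ y} (e : A ≅ A') {X : C.Obj x} {Y : C.Obj y}
    {u : A' ⟶ C.hom X Y} (hu : C.IsTensor A' X Y u) : C.IsTensor A X Y (e.hom ≫ u) := by
  intro z U Z
  have h : (fun f : U ⟶ C.hom Y Z => C.mul (e.hom ≫ u) f) =
      (fun φ : A' ≫ U ⟶ C.hom X Z => e.hom ▷ U ≫ φ) ∘ fun f => C.mul u f :=
    funext fun f => (C.whiskerRight_mul e.hom u f).symm
  rw [h]
  refine Function.Bijective.comp ⟨fun φ ψ hφ => ?_, fun φ => ⟨e.inv ▷ U ≫ φ, ?_⟩⟩ (hu U Z)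
  · exact (cancel_epi (e.hom ▷ U)).1 hφ
  · simp

end WCategory

namespace ParFL

open LexProf

/-! ## Absolute weights are representable -/

/-- The lex profunctor `E(P-, Z-)`. -/
def lexHom {E : Type (v + 1)} [Category.{v} E] {A B : LexProf.{v}} (P : A ⥤ E) (Z : B ⥤ E)
    (hZ : PreservesFiniteLimits Z) : Prof A B where
  obj i j := P.obj i ⟶ Z.obj j
  left f m := P.map f ≫ m
  right g m := m ≫ Z.map g
  left_id m := by simp
  left_comp f g m := by simp
  right_id m := by simp
  right_comp f g m := by simp
  left_right f g m := by simp
  lex i := (inferInstance : PreservesFiniteLimits (Z ⋙ coyoneda.obj (op (P.obj i))))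

/-- The `LexProf`-category of all finite-limit-preserving functors into a category. -/
def lexCat (E : Type (v + 1)) [Category.{v} E] : LexProfCat.{v} where
  Obj A := { X : A ⥤ E // PreservesFiniteLimits X }
  hom X Y := show Prof _ _ from lexHom X.1 Y.1 Y.2
  comp X Y Z :=
    ({ app := Profunctor.Coend.lift (fun (f : X.1.obj _ ⟶ Y.1.obj _) (g : _ ⟶ Z.1.obj _) => f ≫ g)
        (fun β f g => Category.assoc f (Y.1.map β) g)
       app_left := fun f => Profunctor.Coend.ind fun m n => Category.assoc (X.1.map f) m n
       app_right := fun g => Profunctor.Coend.ind fun m n =>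
        (Category.assoc m n (Z.1.map g)).symm } :
      ProfHom ((lexHom X.1 Y.1 Y.2).comp (lexHom Y.1 Z.1 Z.2)) (lexHom X.1 Z.1 Z.2))
  ident X :=
    ({ app := fun f => X.1.map f
       app_left := fun f m => X.1.map_comp f m
       app_right := fun g m => X.1.map_comp m g } :
      ProfHom (Prof.ident _) (lexHom X.1 X.1 X.2))
  ident_comp X Y := Prof.comp_hom_ext fun _ _ => rfl
  comp_ident X Y := Prof.comp_hom_ext fun _ _ => rfl
  comp_assoc X Y Z T := Prof.comp_comp_hom_ext fun f g h => Category.assoc f g h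

/-- The `LexProf`-functor given by composition with a finite-limit-preserving functor. -/
def lexMap {E E' : Type (v + 1)} [Category.{v} E] [Category.{v} E'] (H : E ⥤ E')
    (hH : PreservesFiniteLimits H) : WFunctor (lexCat E) (lexCat E') where
  obj X := ⟨X.1 ⋙ H, have := X.2; comp_preservesFiniteLimits X.1 H⟩
  map X Y :=
    ({ app := fun f => H.map f
       app_left := fun f m => H.map_comp (X.1.map f) m
       app_right := fun g m => H.map_comp m (Y.1.map g) } :
      ProfHom (lexHom X.1 Y.1 Y.2) (lexHom (X.1 ⋙ H) (Y.1 ⋙ H)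
        (have := Y.2; comp_preservesFiniteLimits Y.1 H)))
  map_ident X := rfl
  map_comp X Y Z := Prof.comp_hom_ext fun f g => H.map_comp f g

section

variable {A B : LexProf.{v}} (W : Prof A B)

/-- The functor sending `b` to the presheaf `W(-, b)`. -/
def column : B ⥤ Aᵒᵖ ⥤ Type v where
  obj b :=
    { obj := fun a => W.obj a.unop b
      map := fun f => ↾(W.left f.unop)
      map_id := fun a => by ext m; exact W.left_id m
      map_comp := fun f g => by ext m; exact W.left_comp _ _ m }
  map g :=
    { app := fun a => ↾(W.right g)
      naturality := fun a a' f => by ext m; exact (W.left_right _ _ m).symm }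
  map_id b := by ext a m; exact W.right_id m
  map_comp f g := by ext a m; exact W.right_comp f g m

theorem column_lex : PreservesFiniteLimits (column W) := by
  constructor
  intro J _ _
  apply preservesLimitsOfShape_of_evaluation
  intro a
  exact (W.lex a.unop).preservesFiniteLimits J

/-- The map of presheaves named by an element. -/
def ofElement {a : A} {b : B} (m : W.obj a b) : yoneda.obj a ⟶ (column W).obj b where
  app a' := ↾(fun f : a'.unop ⟶ a => W.left f m)
  naturality a' a'' f := by
    ext g
    exact W.left_comp f.unop g m

theorem ofElement_left {a a' : A} {b : B} (f : a' ⟶ a) (m : W.obj a b) :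
    ofElement W (W.left f m) = yoneda.map f ≫ ofElement W m := by
  ext a'' g
  exact (W.left_comp g f m).symm

theorem ofElement_right {a : A} {b b' : B} (g : b ⟶ b') (m : W.obj a b) :
    ofElement W (W.right g m) = ofElement W m ≫ (column W).map g := by
  ext a'' f
  exact W.left_right f g m

/-- The Yoneda embedding as an object of the `LexProf`-category of presheaves. -/
def yonedaObj (A : LexProf.{v}) : (lexCat (Aᵒᵖ ⥤ Type v)).Obj A := ⟨yoneda, inferInstance⟩

/-- A lex profunctor as an object of the `LexProf`-category of presheaves. -/
def columnObj : (lexCat (Aᵒᵖ ⥤ Type v)).Obj B := ⟨column W, column_lex W⟩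

/-- The map exhibiting `W` as the tensor of the Yoneda embedding by `W`. -/
def columnUnit : (show A ⟶ B from W) ⟶ (lexCat (Aᵒᵖ ⥤ Type v)).hom (yonedaObj A) (columnObj W) :=
  homOfEl (M := W) (C := lexCat (Aᵒᵖ ⥤ Type v)) (X := yonedaObj A) (Y := columnObj W)
    (fun m => ofElement W m) (ofElement_left W) (ofElement_right W)

/-- The map of presheaves from the value of a bimodule map. -/
def columnDesc {K : LexProf.{v}} {U : Prof B K} {Z : K ⥤ Aᵒᵖ ⥤ Type v}
    {hZ : PreservesFiniteLimits Z} (φ : ProfHom (W.comp U) (lexHom yoneda Z hZ)) {b : B} {c : K}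
    (n : U.obj b c) : (column W).obj b ⟶ Z.obj c where
  app a := ↾(fun m => (yonedaEquiv (φ.app (Profunctor.pair m n) : yoneda.obj a.unop ⟶ Z.obj c)))
  naturality a a' f := by
    ext m
    have h : φ.app (Profunctor.pair (W.left f.unop m) n) =
      (yoneda.map f.unop ≫ φ.app (Profunctor.pair m n) : yoneda.obj a'.unop ⟶ Z.obj c) :=
      φ.app_left f.unop (Profunctor.pair m n)
    refine (congrArg (fun t : yoneda.obj a'.unop ⟶ Z.obj c => yonedaEquiv t) h).trans ?_
    exact (yonedaEquiv_naturality (φ.app (Profunctor.pair m n) : yoneda.obj a.unop ⟶ Z.obj c)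
      f.unop).symm

theorem isTensor_column : (lexCat (Aᵒᵖ ⥤ Type v)).IsTensor (show A ⟶ B from W) (yonedaObj A)
    (columnObj W) (columnUnit W) := by
  rintro K (U : Prof B K) ⟨Z, hZ⟩
  constructor
  · intro f g hfg
    refine ProfHom.ext ?_
    funext b c n
    refine NatTrans.ext ?_
    funext a
    ext m
    have h : ofElement W m ≫ (ProfHom.app (M := U) (N := lexHom (column W) Z hZ) f n) =
        ofElement W m ≫ (ProfHom.app (M := U) (N := lexHom (column W) Z hZ) g n) :=
      congrArg (fun σ => ProfHom.app (M := W.comp U) (N := lexHom yoneda Z hZ) σ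
        (Profunctor.pair m n)) hfg
    have h' := congrArg yonedaEquiv h
    have e : W.left (𝟙 a.unop) m = m := W.left_id m
    have h'' : ∀ t : (column W).obj b ⟶ Z.obj c,
        yonedaEquiv (ofElement W m ≫ t) = t.app a m := fun t =>
      congrArg (t.app a) e
    exact (h'' _).symm.trans (h'.trans (h'' _))
  · intro φ
    have φr : ∀ {a : A} {b : B} {c c' : K} (g : c ⟶ c') (m : W.obj a b) (n : U.obj b c),
        ProfHom.app (M := W.comp U) (N := lexHom yoneda Z hZ) φ
          (Profunctor.pair m (U.right g n)) =
        (ProfHom.app (M := W.comp U) (N := lexHom yoneda Z hZ) φ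
          (Profunctor.pair m n) : yoneda.obj a ⟶ Z.obj c) ≫ Z.map g := fun g m n =>
      ProfHom.app_right (M := W.comp U) (N := lexHom yoneda Z hZ) φ g (Profunctor.pair m n)
    refine ⟨({ app := fun n => columnDesc W (hZ := hZ) φ n
               app_left := fun {b b' c} β n => ?_
               app_right := fun {b c c'} g n => ?_ } : ProfHom U (lexHom (column W) Z hZ)), ?_⟩
    · refine NatTrans.ext ?_
      funext a
      ext m
      exact congrArg (fun t : Profunctor.Coend W.toProfunctor U.toProfunctor a.unop c =>
        yonedaEquiv (ProfHom.app (M := W.comp U) (N := lexHom yoneda Z hZ) φ t :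
          yoneda.obj a.unop ⟶ Z.obj c)) (Profunctor.pair_right β m n).symm
    · refine NatTrans.ext ?_
      funext a
      ext m
      exact congrArg (fun t : yoneda.obj a.unop ⟶ Z.obj c' => yonedaEquiv t) (φr g m n)
    · refine Prof.comp_hom_ext (M := W) (N := U) fun {a b c} m n => ?_
      refine yonedaEquiv.injective ?_
      exact congrArg (fun m => yonedaEquiv (ProfHom.app (M := W.comp U) (N := lexHom yoneda Z hZ) φ
        (Profunctor.pair m n) : yoneda.obj a ⟶ Z.obj c)) (W.left_id m)

end

end ParFL

namespace ParFL

open LexProf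

/-- The standard skeleton of the category of finite sets. -/
noncomputable def finSkeleton : LexProf.{v} where
  carrier := FintypeCat.Skeleton.{v}
  lim := ⟨fun J _ _ => Adjunction.hasLimitsOfShape_of_equivalence
    FintypeCat.Skeleton.incl.{v}⟩

/-- The inclusion of finite sets in sets. -/
noncomputable def finIncl : finSkeleton.{v} ⥤ Type v :=
  FintypeCat.Skeleton.incl ⋙ FintypeCat.incl

theorem finIncl_lex : PreservesFiniteLimits finIncl.{v} :=
  comp_preservesFiniteLimits FintypeCat.Skeleton.incl FintypeCat.incl

section

variable {A B : LexProf.{v}} (W : Prof A B)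

/-- The functor sending `b` to the set of maps `W(-, b₀) ⟶ W(-, b)` that factor through a
representable presheaf. -/
def factoring (b₀ : B) : B ⥤ Type v where
  obj b := { t : (column W).obj b₀ ⟶ (column W).obj b //
    ∃ (a : A) (m : W.obj a b) (h : (column W).obj b₀ ⟶ yoneda.obj a), t = h ≫ ofElement W m }
  map g := ↾(fun t => ⟨t.1 ≫ (column W).map g, by
    obtain ⟨a, m, h, e⟩ := t.2
    exact ⟨a, W.right g m, h, by rw [e, ofElement_right, Category.assoc]⟩⟩)
  map_id b := by
    refine ConcreteCategory.hom_ext _ _ fun t => ?_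
    exact Subtype.ext ((congrArg (t.1 ≫ ·) ((column W).map_id b)).trans (Category.comp_id _))
  map_comp f g := by
    refine ConcreteCategory.hom_ext _ _ fun t => ?_
    exact Subtype.ext ((congrArg (t.1 ≫ ·) ((column W).map_comp f g)).trans
      (Category.assoc _ _ _).symm)

theorem exists_factorization (hW : WCategory.AbsoluteTensorsBy.{v, v + 1, v + 1, v + 1}
      (show A ⟶ B from W)) (b₀ : B) :
    ∃ (a : A) (m : W.obj a b₀) (h : (column W).obj b₀ ⟶ yoneda.obj a),
      𝟙 ((column W).obj b₀) = h ≫ ofElement W m := by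
  let H : (Aᵒᵖ ⥤ Type v) ⥤ Type v := coyoneda.obj (op ((column W).obj b₀))
  have hH : PreservesFiniteLimits H := inferInstance
  have hT := hW _ _ (lexMap H hH) _ _ _ (isTensor_column W)
  let U : Prof B finSkeleton.{v} := lexHom (factoring W b₀) finIncl finIncl_lex
  let V : Prof B finSkeleton.{v} := lexHom (column W ⋙ H) finIncl finIncl_lex
  let P : Prof A finSkeleton.{v} := lexHom (yoneda ⋙ H) finIncl finIncl_lex
  let Z : (lexCat (Type v)).Obj finSkeleton.{v} := ⟨finIncl, finIncl_lex⟩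
  let φ : ProfHom (W.comp U) P :=
    { app := fun {a c} => Profunctor.Coend.lift
        (fun {b} (m : W.obj a b) (g : (factoring W b₀).obj b ⟶ finIncl.obj c) =>
          (↾(fun h => g ⟨h ≫ ofElement W m, a, m, h, rfl⟩) :
            (yoneda ⋙ H).obj a ⟶ finIncl.obj c))
        (fun {b b'} β m n => by
          change (_ : (yoneda ⋙ H).obj a ⟶ finIncl.obj c) = _
          refine ConcreteCategory.hom_ext _ _ fun h => ?_
          refine congrArg (ConcreteCategory.hom (C := Type v) n) (Subtype.ext ?_)
          exact (congrArg (h ≫ ·) (ofElement_right W β m)).trans (Category.assoc _ _ _).symm)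
      app_left := fun {a a' c} f => Profunctor.Coend.ind fun {b} m
          (n : (factoring W b₀).obj b ⟶ finIncl.obj c) => by
        change (_ : (yoneda ⋙ H).obj a' ⟶ finIncl.obj c) = _
        refine ConcreteCategory.hom_ext _ _ fun h => ?_
        refine congrArg (ConcreteCategory.hom (C := Type v) n) (Subtype.ext ?_)
        exact (congrArg (h ≫ ·) (ofElement_left W f m)).trans (Category.assoc _ _ _).symm
      app_right := fun {a c c'} g => Profunctor.Coend.ind fun m n => rfl }
  obtain ⟨f, hf⟩ := (hT (show B ⟶ finSkeleton from U) Z).2 φ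
  let r : ProfHom V U :=
    { app := fun {b c} (t : (column W ⋙ H).obj b ⟶ finIncl.obj c) =>
        (↾(fun s => t s.1) : (factoring W b₀).obj b ⟶ finIncl.obj c)
      app_left := fun β t => rfl
      app_right := fun g t => rfl }
  have hrf : (r : V ⟶ U) ≫ (f : U ⟶ V) = 𝟙 V := by
    refine (hT (show B ⟶ finSkeleton from V) Z).1 ?_
    refine Prof.comp_hom_ext (M := W) (N := V) fun {a b c} m t => ?_
    exact congrArg (fun σ => ProfHom.app (M := W.comp U) (N := P) σ
      (Profunctor.pair m (r.app t))) hf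
  let two : finSkeleton.{v} := FintypeCat.Skeleton.mk 2
  let x₀ : finIncl.obj two := (⟨0⟩ : ULift (Fin 2))
  let x₁ : finIncl.obj two := (⟨1⟩ : ULift (Fin 2))
  have hx : x₁ ≠ x₀ := fun h => by
    have h' : (1 : Fin 2) = 0 := congrArg ULift.down h
    exact absurd h' (by decide)
  let t₁ : (column W ⋙ H).obj b₀ ⟶ finIncl.obj two := ↾(fun _ => x₁)
  let t₂ : (column W ⋙ H).obj b₀ ⟶ finIncl.obj two := by
    classical
    exact ↾(fun t => if ∃ (a : A) (m : W.obj a b₀) (h : (column W).obj b₀ ⟶ yoneda.obj a),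
      t = h ≫ ofElement W m then x₁ else x₀)
  have hr : r.app t₁ = r.app t₂ := by
    change (_ : (factoring W b₀).obj b₀ ⟶ finIncl.obj two) = _
    ext s
    exact (if_pos s.2).symm
  have ht : t₁ = t₂ := by
    have h : ∀ t : V.obj b₀ two, ProfHom.app (M := U) (N := V) f (r.app t) = t := fun t =>
      congrArg (fun σ => ProfHom.app (M := V) (N := V) σ t) hrf
    exact (h t₁).symm.trans ((congrArg (ProfHom.app (M := U) (N := V) f) hr).trans (h t₂))
  by_contra hn
  have h := congrArg (fun t => t (𝟙 ((column W).obj b₀))) ht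
  exact hx (h.trans (if_neg hn))

theorem representable_of_factorization {b : B} {a : A} (m : W.obj a b)
    (h : (column W).obj b ⟶ yoneda.obj a) (e : 𝟙 ((column W).obj b) = h ≫ ofElement W m) :
    ∃ (g : A) (θ : W.obj g b), ∀ a' : A,
      Function.Bijective fun f : a' ⟶ g => W.left f θ := by
  let k : ∀ {a' : A}, W.obj a' b → (a' ⟶ a) := fun {a'} n => h.app (op a') n
  have k_left : ∀ {a' a'' : A} (f : a'' ⟶ a') (n : W.obj a' b), k (W.left f n) = f ≫ k n :=
    fun f n => NatTrans.naturality_apply h f.op n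
  have left_k : ∀ {a' : A} (n : W.obj a' b), W.left (k n) m = n := fun {a'} n =>
    (congrArg (fun t : (column W).obj b ⟶ (column W).obj b => t.app (op a') n) e).symm
  have hidem : k m ≫ k m = k m := by rw [← k_left, left_k]
  have : IsIdempotentComplete A :=
    (Idempotents.isIdempotentComplete_iff_hasEqualizer_of_id_and_idempotent A).2
      fun X p _ => inferInstance
  obtain ⟨g, i, p, hip, hpi⟩ := IsIdempotentComplete.idempotents_split a (k m) hidem
  have left_i : ∀ {a' : A} (f : a' ⟶ g), k (W.left f (W.left i m)) = f ≫ i := fun f => by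
    rw [← W.left_comp, k_left, ← hpi, Category.assoc, ← Category.assoc i, hip, Category.id_comp]
  refine ⟨g, W.left i m, fun a' => ⟨fun f f' hff => ?_, fun n => ⟨k n ≫ p, ?_⟩⟩⟩
  · have h' := congrArg (fun x => k x ≫ p) hff
    dsimp only at h'
    rw [left_i, left_i, Category.assoc, Category.assoc, hip, Category.comp_id,
      Category.comp_id] at h'
    exact h'
  · dsimp only
    rw [← W.left_comp, Category.assoc, hpi, ← k_left, left_k, left_k]

theorem exists_iso_weight (hr : ∀ b : B, ∃ (g : A) (θ : W.obj g b), ∀ a' : A,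
      Function.Bijective fun f : a' ⟶ g => W.left f θ) :
    ∃ (F : B ⥤ A) (hF : PreservesFiniteLimits F), Nonempty (weight F hF ≅ W) := by
  choose g θ hθ using hr
  have inj : ∀ {a : A} {b : B} {f f' : a ⟶ g b}, W.left f (θ b) = W.left f' (θ b) → f = f' :=
    fun h => (hθ _ _).1 h
  choose q hq using fun {a : A} {b : B} (m : W.obj a b) => (hθ b a).2 m
  dsimp only at hq
  let F : B ⥤ A :=
    { obj := g
      map := fun β => q (W.right β (θ _))
      map_id := fun b => inj (by rw [hq, W.right_id, W.left_id])
      map_comp := fun β γ => inj (by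
        rw [hq, W.left_comp, hq, W.left_right, hq, W.right_comp]) }
  have hF : PreservesFiniteLimits F := by
    refine ⟨fun J _ _ => ⟨fun {K} => ⟨fun {c} hc =>
      ⟨coyonedaJointlyReflectsLimits _ _ fun x => ?_⟩⟩⟩⟩
    have e : F ⋙ coyoneda.obj (op x.unop) ≅ Profunctor.fib W.toProfunctor x.unop :=
      NatIso.ofComponents (fun b => (Equiv.ofBijective _ (hθ b x.unop)).toIso) (by
        intro b b' β
        ext f
        change W.left (f ≫ q (W.right β (θ b))) (θ b') = W.right β (W.left f (θ b))
        rw [W.left_comp, hq, W.left_right])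
    have := W.lex x.unop
    have : PreservesFiniteLimits (F ⋙ coyoneda.obj (op x.unop)) :=
      preservesFiniteLimits_of_natIso e.symm
    exact isLimitOfPreserves (F ⋙ coyoneda.obj (op x.unop)) hc
  refine ⟨F, hF, ⟨?_⟩⟩
  exact
    { hom := ({ app := fun {a b} (f : a ⟶ g b) => W.left f (θ b)
                app_left := fun f m => W.left_comp f m _
                app_right := fun {a b b'} β (m : a ⟶ g b) => by
                  change W.left (m ≫ q (W.right β (θ b))) (θ b') = W.right β (W.left m (θ b))
                  rw [W.left_comp, hq, W.left_right] } : ProfHom (weight F hF) W)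
      inv := ({ app := fun {a b} m => q m
                app_left := fun {a a' b} f m => inj (by
                  change W.left (q (W.left f m)) (θ b) = W.left (f ≫ q m) (θ b)
                  rw [hq, W.left_comp, hq])
                app_right := fun {a b b'} β m => inj (by
                  change W.left (q (W.right β m)) (θ b') =
                    W.left (q m ≫ q (W.right β (θ b))) (θ b')
                  rw [hq, W.left_comp, hq, W.left_right, hq]) } : ProfHom W (weight F hF))
      hom_inv_id := ProfHom.ext (by
        funext a b f
        exact inj (hq _))
      inv_hom_id := ProfHom.ext (by
        funext a b m
        exact hq m) }

/-- A weight, tensors by which are absolute, is representable. -/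
theorem exists_iso_weight_of_absolute (hW : WCategory.AbsoluteTensorsBy.{v, v + 1, v + 1, v + 1}
      (show A ⟶ B from W)) :
    ∃ (F : B ⥤ A) (hF : PreservesFiniteLimits F), Nonempty (weight F hF ≅ W) :=
  exists_iso_weight W fun b => by
    obtain ⟨a, m, h, e⟩ := exists_factorization W hW b
    exact representable_of_factorization W m h e

end

theorem gammaObj_isAbsoluteTensored (D : ParFL.{v}) : (gammaObj D).IsAbsoluteTensored := by
  intro A B W hW X
  obtain ⟨F, hF, ⟨e⟩⟩ := exists_iso_weight_of_absolute W hW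
  obtain ⟨Y, u, hu⟩ := gammaObj_hasTensor_weight D F hF X
  exact ⟨Y, _, WCategory.IsTensor.of_iso (A := W) (show W ≅ (show A ⟶ B from weight F hF) from
    ⟨e.inv, e.hom, e.inv_hom_id, e.hom_inv_id⟩) hu⟩

end ParFL

namespace CategoryTheory.Bicategory.Equivalence

/-- The inverse of an equivalence. -/
noncomputable def symm {B : Type u} [Bicategory.{w, v} B] {a b : B} (e : a ≌ b) : b ≌ a :=
  mkOfAdjointifyCounit e.counit.symm e.unit.symm

end CategoryTheory.Bicategory.Equivalence

namespace WCategory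

section

variable {W : Type u} [Bicategory.{w, v} W] {C D : WCategory.{w, v, u, o} W}

theorem mul_bijective_of_inverse {x z : W} {X X' : C.Obj x} {Z : C.Obj z}
    {s : 𝟙 x ⟶ C.hom X X'} {t : 𝟙 x ⟶ C.hom X' X}
    (hst : (λ_ (𝟙 x)).inv ≫ C.mul s t = C.ident X)
    (hts : (λ_ (𝟙 x)).inv ≫ C.mul t s = C.ident X') (V : x ⟶ z) :
    Function.Bijective fun ψ : V ⟶ C.hom X' Z => (λ_ V).inv ≫ C.mul s ψ := by
  have key : ∀ {X X' : C.Obj x} {s : 𝟙 x ⟶ C.hom X X'} {t : 𝟙 x ⟶ C.hom X' X}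
      (_ : (λ_ (𝟙 x)).inv ≫ C.mul s t = C.ident X) (ψ : V ⟶ C.hom X Z),
      (λ_ V).inv ≫ C.mul s ((λ_ V).inv ≫ C.mul t ψ) = ψ := by
    intro X X' s t hst ψ
    have h := C.mul_assoc s t ψ
    have e : ψ = (λ_ V).inv ≫ C.mul (C.ident X) ψ := by simp [C.ident_mul]
    conv_rhs => rw [e, ← hst, ← C.whiskerRight_mul]
    rw [← C.whiskerLeft_mul, (Iso.eq_inv_comp _).mpr h.symm]
    simp only [leftUnitor_inv_naturality_assoc, Iso.inv_hom_id_assoc, ← Category.assoc]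
    congr 1
    bicategory_coherence
  exact Function.bijective_iff_has_inverse.2 ⟨fun ψ => (λ_ V).inv ≫ C.mul t ψ,
    fun ψ => key hts ψ, fun ψ => key hst ψ⟩

theorem IsTensor.of_inverse {x y : W} {A : x ⟶ y} {X X' : C.Obj x} {Y : C.Obj y}
    {s : 𝟙 x ⟶ C.hom X X'} {t : 𝟙 x ⟶ C.hom X' X}
    (hst : (λ_ (𝟙 x)).inv ≫ C.mul s t = C.ident X)
    (hts : (λ_ (𝟙 x)).inv ≫ C.mul t s = C.ident X') {u : A ⟶ C.hom X' Y}
    (hu : C.IsTensor A X' Y u) : C.IsTensor A X Y ((λ_ A).inv ≫ C.mul s u) := by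
  intro z U Z
  have h : (fun f : U ⟶ C.hom Y Z => C.mul ((λ_ A).inv ≫ C.mul s u) f) =
      (fun ψ : A ≫ U ⟶ C.hom X' Z => (λ_ (A ≫ U)).inv ≫ C.mul s ψ) ∘ fun f => C.mul u f := by
    funext f
    dsimp only [Function.comp]
    rw [← C.whiskerRight_mul, C.mul_assoc]
    simp
  rw [h]
  exact (mul_bijective_of_inverse hst hts (A ≫ U)).comp (hu U Z)

/-- Being absolute-tensored is invariant under equivalence. -/
theorem IsAbsoluteTensored.of_equivalence (hC : C.IsAbsoluteTensored) (e : C ≌ D) :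
    D.IsAbsoluteTensored := by
  intro x y A hA X
  obtain ⟨Y, u, hu⟩ := hC A hA (WFunctor.obj e.inv X)
  have h := hA _ _ e.hom _ _ u hu
  have h₁ := congrArg (fun σ => WTrans.app σ X) e.counit.inv_hom_id
  have h₂ := congrArg (fun σ => WTrans.app σ X) e.counit.hom_inv_id
  exact ⟨_, _, IsTensor.of_inverse (X := X) (X' := WFunctor.obj e.hom (WFunctor.obj e.inv X))
    (s := WTrans.app e.counit.inv X) (t := WTrans.app e.counit.hom X) h₁ h₂ h⟩

end

end WCategory

namespace ParFL

open LexProf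

section

variable {C : LexProfCat.{v}}

/-- A tensor by a representable weight is restriction along the representing functor. -/
noncomputable def iotaIsoOfTensor {A B : LexProf.{v}} {F : B ⥤ A} {hF : PreservesFiniteLimits F}
    {X : C.Obj A} {Y : C.Obj B} (u : (show A ⟶ B from weight F hF) ⟶ C.hom X Y)
    (w : ∀ b, el C Y X b (F.obj b)) (h₁ : ∀ b, elComp (unitEl u b) (w b) = elId C X (𝟙 _))
    (h₂ : ∀ b, elComp (w b) (unitEl u b) = elId C Y (𝟙 b)) : F ⋙ iota C X ≅ iota C Y :=
  NatIso.ofComponents (fun b => elIso (unitEl u b) (w b) (h₁ b) (h₂ b))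
    (fun β => (unitEl_naturality u β).symm)

/-- An isomorphism of members of the sieve of `D` gives an isomorphism in `∫ Γ(D)`. -/
def iotaGammaIso {D : ParFL.{v}} {A : LexProf.{v}} {X Y : (gammaObj D).Obj A} (e : X.1 ≅ Y.1) :
    iota (gammaObj D) X ≅ iota (gammaObj D) Y :=
  NatIso.ofComponents (fun i => elIso (C := gammaObj D) (X := X) (Y := Y) (e.hom.app i)
      (e.inv.app i) ((e.hom_inv_id_app i).trans (X.1.map_id i).symm)
      ((e.inv_hom_id_app i).trans (Y.1.map_id i).symm))
    (fun φ => e.hom.naturality φ)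

theorem exists_pre (hC : C.IsAbsoluteTensored) {A : LexProf.{v}}
    (Z : (gammaObj (intObj C)).Obj A) : ∃ X : C.Obj A,
      Nonempty (iota (gammaObj (intObj C)) (WFunctor.obj (eta C) X) ≅
        iota (gammaObj (intObj C)) Z) := by
  obtain ⟨B, Y, F, hF, ⟨e⟩⟩ := Z.2
  obtain ⟨X, u, hu⟩ := hC _ (absoluteTensorsBy_weight F hF) Y
  obtain ⟨w, h₁, h₂⟩ := inverse_of_isTensor u hu
  exact ⟨X, ⟨iotaGammaIso (D := intObj C) (X := WFunctor.obj (eta C) X)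
    ((iotaIsoOfTensor u w h₁ h₂).symm ≪≫ e.symm)⟩⟩

/-- The unit at an absolute-tensored `LexProf`-category is fully faithful and essentially
surjective. -/
noncomputable def etaSplitEquivalence (hC : C.IsAbsoluteTensored) :
    SplitEquivalence (C := C) (D := gammaObj (intObj C)) (eta C) where
  bij X Y i j := Function.bijective_id
  pre Z := (exists_pre hC Z).choose
  iso Z := (exists_pre hC Z).choose_spec.some

end

theorem essImage_gamma (C : LexProfCat.{v}) :
    (∃ D : ParFL.{v}, Nonempty (Gamma.obj D ≌ C)) ↔ C.IsAbsoluteTensored := by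
  constructor
  · rintro ⟨D, ⟨e⟩⟩
    exact (gammaObj_isAbsoluteTensored D).of_equivalence e
  · intro hC
    exact ⟨intObj C, ⟨(etaSplitEquivalence hC).equivalence.symm⟩⟩

end ParFL

/-! ## Pseudonatural transformations whose components are equivalences -/

namespace CategoryTheory

universe w₁ w₂ v₁ v₂ u₁ u₂

namespace Bicategory

variable {B : Type u₁} [Bicategory.{w₁, v₁} B]

theorem postcomp_isEquivalence {a b : B} (c : B) {f : a ⟶ b} {g : b ⟶ a} (η : 𝟙 a ≅ f ≫ g)
    (κ : g ≫ f ≅ 𝟙 b) : (postcomp c f).IsEquivalence :=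
  (CategoryTheory.Equivalence.mk (postcomp c f) (postcomp c g)
    (((rightUnitorNatIso c a).symm ≪≫ (postcomposing c a a).mapIso η) ≪≫
      (associatorNatIsoLeft c f g).symm)
    (associatorNatIsoLeft c g f ≪≫ (postcomposing c b b).mapIso κ ≪≫
      rightUnitorNatIso c b)).isEquivalence_functor

end Bicategory

namespace Pseudofunctor.StrongTrans

open Bicategory

open scoped Pseudofunctor.StrongTrans

variable {B : Type u₁} [Bicategory.{w₁, v₁} B] {C : Type u₂} [Bicategory.{w₂, v₂} C]
  {F G : B ⥤ᵖ C}

section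

variable (η : F ⟶ G) (inv : ∀ a, G.obj a ⟶ F.obj a) (counit : ∀ a, inv a ≫ η.app a ≅ 𝟙 (G.obj a))

/-- The comparison isomorphism given by conjugation with the counits. -/
def conj {a b : B} (x : G.obj a ⟶ G.obj b) :
    (x ≫ inv b) ≫ η.app b ≅ inv a ≫ η.app a ≫ x :=
  α_ _ _ _ ≪≫ whiskerLeftIso x (counit b) ≪≫ ρ_ _ ≪≫ (λ_ _).symm ≪≫
    whiskerRightIso (counit a).symm x ≪≫ α_ _ _ _

theorem conj_naturality {a b : B} {x y : G.obj a ⟶ G.obj b} (τ : x ⟶ y) :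
    τ ▷ inv b ▷ η.app b ≫ (conj η inv counit y).hom =
      (conj η inv counit x).hom ≫ inv a ◁ η.app a ◁ τ := by
  simp only [conj, Iso.trans_hom, whiskerLeftIso_hom, whiskerRightIso_hom, Iso.symm_hom,
    Category.assoc]
  rw [associator_naturality_left_assoc, ← whisker_exchange_assoc, rightUnitor_naturality_assoc,
    leftUnitor_inv_naturality_assoc, whisker_exchange_assoc, associator_naturality_right]

theorem conj_id (a : B) :
    (conj η inv counit (𝟙 (G.obj a))).hom =
      (λ_ (inv a)).hom ▷ η.app a ≫ inv a ◁ (ρ_ (η.app a)).inv := by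
  simp only [conj, Iso.trans_hom, whiskerLeftIso_hom, whiskerRightIso_hom, Iso.symm_hom,
    Category.assoc]
  rw [← unitors_equal, leftUnitor_naturality_assoc, unitors_inv_equal,
    ← rightUnitor_inv_naturality_assoc, Iso.hom_inv_id_assoc]
  simp

theorem conj_comp {a b c : B} (x : G.obj a ⟶ G.obj b) (y : G.obj b ⟶ G.obj c) :
    (conj η inv counit (x ≫ y)).hom =
      𝟙 _ ⊗≫ x ◁ (conj η inv counit y).hom ⊗≫ (conj η inv counit x).hom ▷ y ⊗≫ 𝟙 _ := by
  simp only [conj, Iso.trans_hom, whiskerLeftIso_hom, whiskerRightIso_hom, Iso.symm_hom]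
  calc
    _ = 𝟙 _ ⊗≫ x ◁ y ◁ (counit c).hom ⊗≫ x ◁ 𝟙 (𝟙 (G.obj b)) ▷ y ⊗≫
        (counit a).inv ▷ x ▷ y ⊗≫ 𝟙 _ := by bicategory
    _ = 𝟙 _ ⊗≫ x ◁ y ◁ (counit c).hom ⊗≫ x ◁ ((counit b).inv ≫ (counit b).hom) ▷ y ⊗≫
        (counit a).inv ▷ x ▷ y ⊗≫ 𝟙 _ := by rw [Iso.inv_hom_id]
    _ = _ := by bicategory

variable [∀ (c : C) (b : B), (postcomp c (η.app b)).Full]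
  [∀ (c : C) (b : B), (postcomp c (η.app b)).Faithful]

/-- The pseudonaturality constraint of a pseudo-inverse. -/
noncomputable def sectionNaturality {a b : B} (f : a ⟶ b) :
    G.map f ≫ inv b ≅ inv a ≫ F.map f :=
  (postcomp (G.obj a) (η.app b)).preimageIso (conj η inv counit (G.map f) ≪≫
    whiskerLeftIso (inv a) (η.naturality f).symm ≪≫ (α_ _ _ _).symm)

theorem sectionNaturality_whiskerRight {a b : B} (f : a ⟶ b) :
    (sectionNaturality η inv counit f).hom ▷ η.app b = (conj η inv counit (G.map f)).hom ≫
      inv a ◁ (η.naturality f).inv ≫ (α_ _ _ _).inv :=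
  (postcomp (G.obj a) (η.app b)).map_preimage _

theorem sectionNaturality_naturality {a b : B} {f g : a ⟶ b} (τ : f ⟶ g) :
    G.map₂ τ ▷ inv b ≫ (sectionNaturality η inv counit g).hom =
      (sectionNaturality η inv counit f).hom ≫ inv a ◁ F.map₂ τ := by
  apply (postcomp (G.obj a) (η.app b)).map_injective
  have h : η.app a ◁ G.map₂ τ ≫ (η.naturality g).inv =
      (η.naturality f).inv ≫ F.map₂ τ ▷ η.app b := by
    rw [Iso.eq_inv_comp, ← Category.assoc, Iso.comp_inv_eq, naturality_naturality]
  simp only [postcomp_map, comp_whiskerRight, sectionNaturality_whiskerRight, Category.assoc]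
  rw [← Category.assoc, conj_naturality, Category.assoc, ← whiskerLeft_comp_assoc, h]
  simp
  rfl

theorem sectionNaturality_id (a : B) :
    (sectionNaturality η inv counit (𝟙 a)).hom ≫ inv a ◁ (F.mapId a).hom =
      (G.mapId a).hom ▷ inv a ≫ (λ_ (inv a)).hom ≫ (ρ_ (inv a)).inv := by
  apply (postcomp (G.obj a) (η.app a)).map_injective
  have h := conj_naturality η inv counit (G.mapId a).hom
  simp only [postcomp_map, comp_whiskerRight, sectionNaturality_whiskerRight, Category.assoc,
    naturality_id_inv, whiskerLeft_comp]
  rw [← reassoc_of% h, conj_id]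
  simp
  rfl

theorem sectionNaturality_comp {a b c : B} (f : a ⟶ b) (g : b ⟶ c) :
    (sectionNaturality η inv counit (f ≫ g)).hom ≫ inv a ◁ (F.mapComp f g).hom =
      (G.mapComp f g).hom ▷ inv c ≫ (α_ _ _ _).hom ≫
        G.map f ◁ (sectionNaturality η inv counit g).hom ≫ (α_ _ _ _).inv ≫
          (sectionNaturality η inv counit f).hom ▷ F.map g ≫ (α_ _ _ _).hom := by
  apply (postcomp (G.obj a) (η.app c)).map_injective
  have h := conj_naturality η inv counit (G.mapComp f g).hom
  have key : (α_ (G.map f) (G.map g) (inv c)).hom ▷ η.app c ≫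
      (G.map f ◁ (sectionNaturality η inv counit g).hom) ▷ η.app c ≫
        (α_ (G.map f) (inv b) (F.map g)).inv ▷ η.app c ≫
          (sectionNaturality η inv counit f).hom ▷ F.map g ▷ η.app c ≫
            (α_ (inv a) (F.map f) (F.map g)).hom ▷ η.app c =
      (conj η inv counit (G.map f ≫ G.map g)).hom ⊗≫ inv a ◁ (η.naturality f).inv ▷ G.map g ⊗≫
        inv a ◁ F.map f ◁ (η.naturality g).inv ⊗≫ 𝟙 _ := by
    calc
      _ = 𝟙 _ ⊗≫ G.map f ◁ ((sectionNaturality η inv counit g).hom ▷ η.app c) ⊗≫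
          (sectionNaturality η inv counit f).hom ▷ (F.map g ≫ η.app c) ⊗≫ 𝟙 _ := by
        bicategory
      _ = 𝟙 _ ⊗≫ G.map f ◁ (conj η inv counit (G.map g)).hom ⊗≫
          ((G.map f ≫ inv b) ◁ (η.naturality g).inv ≫
            (sectionNaturality η inv counit f).hom ▷ (F.map g ≫ η.app c)) ⊗≫ 𝟙 _ := by
        rw [sectionNaturality_whiskerRight]
        bicategory
      _ = 𝟙 _ ⊗≫ G.map f ◁ (conj η inv counit (G.map g)).hom ⊗≫
          ((sectionNaturality η inv counit f).hom ▷ η.app b) ▷ G.map g ⊗≫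
            inv a ◁ F.map f ◁ (η.naturality g).inv ⊗≫ 𝟙 _ := by
        rw [whisker_exchange]
        bicategory
      _ = (𝟙 _ ⊗≫ G.map f ◁ (conj η inv counit (G.map g)).hom ⊗≫
          (conj η inv counit (G.map f)).hom ▷ G.map g ⊗≫
            𝟙 (inv a ≫ η.app a ≫ G.map f ≫ G.map g)) ⊗≫
            inv a ◁ (η.naturality f).inv ▷ G.map g ⊗≫
              inv a ◁ F.map f ◁ (η.naturality g).inv ⊗≫ 𝟙 _ := by
        rw [sectionNaturality_whiskerRight]
        bicategory
      _ = _ := by rw [← conj_comp]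
  simp only [postcomp_map, comp_whiskerRight]
  rw [key]
  simp only [sectionNaturality_whiskerRight, Category.assoc, naturality_comp_inv,
    whiskerLeft_comp]
  rw [← reassoc_of% h]
  simp [bicategoricalComp]
  rfl

/-- The pseudo-inverse of a pseudonatural transformation. -/
noncomputable def sect : G ⟶ F where
  app := inv
  naturality f := sectionNaturality η inv counit f
  naturality_naturality := sectionNaturality_naturality η inv counit
  naturality_id := sectionNaturality_id η inv counit
  naturality_comp := sectionNaturality_comp η inv counit

/-- The pseudo-inverse is a section. -/
noncomputable def sectIso : sect η inv counit ≫ η ≅ 𝟙 G :=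
  isoMk (fun a => counit a) (fun {a b} f => by
    change G.map f ◁ (counit b).hom ≫ (ρ_ (G.map f)).hom ≫ (λ_ (G.map f)).inv =
      ((α_ (G.map f) (inv b) (η.app b)).inv ≫
        (sectionNaturality η inv counit f).hom ▷ η.app b ≫
          (α_ (inv a) (F.map f) (η.app b)).hom ≫ inv a ◁ (η.naturality f).hom ≫
            (α_ (inv a) (η.app a) (G.map f)).inv) ≫ (counit a).hom ▷ G.map f
    rw [sectionNaturality_whiskerRight]
    simp [conj])

end

/-- A pseudonatural transformation whose components are equivalences is an equivalence. -/
theorem nonempty_equivalence (η : F ⟶ G) (inv : ∀ a, G.obj a ⟶ F.obj a)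
    (unit : ∀ a, 𝟙 (F.obj a) ≅ η.app a ≫ inv a) (counit : ∀ a, inv a ≫ η.app a ≅ 𝟙 (G.obj a)) :
    Nonempty (F ≌ G) := by
  have h₁ := fun (c : C) b => postcomp_isEquivalence c (unit b) (counit b)
  let θ : G ⟶ F := sect η inv counit
  have h₂ : ∀ (c : C) b, (postcomp c (θ.app b)).IsEquivalence := fun c b =>
    postcomp_isEquivalence c (counit b).symm (unit b).symm
  let η' : F ⟶ G := sect θ η.app (fun a => (unit a).symm)
  let e₁ : θ ≫ η ≅ 𝟙 G := sectIso η inv counit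
  let e₂ : η' ≫ θ ≅ 𝟙 F := sectIso θ η.app (fun a => (unit a).symm)
  let e : η ≅ η' := (λ_ η).symm ≪≫ whiskerRightIso e₂.symm η ≪≫ α_ _ _ _ ≪≫
    whiskerLeftIso η' e₁ ≪≫ ρ_ η'
  exact ⟨Bicategory.Equivalence.mkOfAdjointifyCounit (f := η) (g := θ)
    (e₂.symm ≪≫ whiskerRightIso e.symm θ) e₁⟩

end Pseudofunctor.StrongTrans

end CategoryTheory

namespace ParFL

open LexProf

open scoped Pseudofunctor.StrongTrans

/-! ## The biequivalence -/

theorem gamma_isAbsoluteTensored (D : ParFL.{v}) : (Gamma.obj D).IsAbsoluteTensored :=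
  gammaObj_isAbsoluteTensored D

/-- The full sub-2-category of absolute-tensored `LexProf`-categories. -/
abbrev AbsTensored : Type (v + 2) :=
  Bicategory.FullSub fun C : LexProfCat.{v} => C.IsAbsoluteTensored

/-- The 2-functor `Γ` with values in absolute-tensored `LexProf`-categories. -/
def gammaAbs : ParFL.{v} ⥤ᵖ AbsTensored.{v} :=
  Gamma.{v}.toPseudofunctor.liftFullSub (fun C : LexProfCat.{v} => C.IsAbsoluteTensored)
    gamma_isAbsoluteTensored

/-- The restriction of the 2-functor `∫` to absolute-tensored `LexProf`-categories. -/
def intAbs : AbsTensored.{v} ⥤ᵖ ParFL.{v} :=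
  InducedBicategory.forget.toPseudofunctor.comp Integral.{v}.toPseudofunctor

/-- The counit as a pseudonatural transformation. -/
def epsTrans : gammaAbs.{v}.comp intAbs ⟶ Pseudofunctor.id ParFL.{v} where
  app D := epsHom D
  naturality {C D} F := Hom.isoMk (F := (intMap (gammaMap F)).comp (epsHom D))
    (G := (epsHom C).comp F) (Iso.refl _)
  naturality_naturality {C D F G} τ := NatTrans.ext (by
    funext (x : IntObj (gammaObj C))
    change (NatTrans.app τ ((eps C).obj x) ≫ G.functor.map ((eps C).map (𝟙 x))) ≫
      𝟙 (G.functor.obj ((eps C).obj x)) =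
        𝟙 (F.functor.obj ((eps C).obj x)) ≫ NatTrans.app τ ((eps C).obj x)
    simp only [CategoryTheory.Functor.map_id, Category.comp_id, Category.id_comp])
  naturality_id C := NatTrans.ext (by
    funext (x : IntObj (gammaObj C))
    change 𝟙 ((eps C).obj x) ≫ 𝟙 ((eps C).obj x) =
      ((eps C).map (𝟙 x) ≫ (eps C).map (𝟙 x) ≫ (eps C).map (𝟙 x)) ≫
        𝟙 ((eps C).obj x) ≫ 𝟙 ((eps C).obj x)
    simp only [CategoryTheory.Functor.map_id, Category.comp_id])
  naturality_comp {C D E} F G := NatTrans.ext (by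
    funext (x : IntObj (gammaObj C))
    let y : E := G.functor.obj (F.functor.obj ((eps C).obj x))
    let t : y ⟶ y := G.functor.map (F.functor.map ((eps C).map (𝟙 x)))
    have ht : t = 𝟙 y := by simp only [t, y, CategoryTheory.Functor.map_id]
    change 𝟙 y ≫ 𝟙 y = (t ≫ t ≫ t) ≫ 𝟙 y ≫ 𝟙 y ≫ 𝟙 y ≫ G.functor.map (𝟙 _) ≫ 𝟙 y
    rw [ht, CategoryTheory.Functor.map_id]
    change 𝟙 y ≫ 𝟙 y = (𝟙 y ≫ 𝟙 y ≫ 𝟙 y) ≫ 𝟙 y ≫ 𝟙 y ≫ 𝟙 y ≫ 𝟙 y ≫ 𝟙 y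
    simp only [Category.comp_id])

theorem transpose₂_isoOfTranspose {C : LexProfCat.{v}} {D : ParFL.{v}} {S T : C ⟶ gammaObj D}
    (e : transpose S ≅ transpose T) :
    transpose₂ (S := S) (T := T) (isoOfTranspose e).hom = e.hom := by
  refine (congrArg (fun t => Functor.whiskerRight t (eps D))
    (intMap₂_wTransMk (F := S) (G := T) _)).trans ?_
  exact ((Functor.FullyFaithful.ofFullyFaithful (eps D)).whiskeringRight
    (IntObj C)).map_preimage e.hom

/-- The pseudonaturality constraint of the unit. -/
noncomputable def etaIso {C D : LexProfCat.{v}} (F : C ⟶ D) :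
    F ≫ eta D ≅ eta C ≫ Gamma.map (Integral.map F) :=
  isoOfTranspose (D := intObj D) (S := F ≫ eta D) (T := eta C ≫ Gamma.map (Integral.map F))
    (Iso.refl (intFunctor F))

theorem transpose₂_etaIso {C D : LexProfCat.{v}} (F : C ⟶ D) :
    transpose₂ (D := intObj D) (S := F ≫ eta D) (T := eta C ≫ Gamma.map (Integral.map F))
      (etaIso F).hom = 𝟙 (intFunctor F) :=
  transpose₂_isoOfTranspose _

theorem transpose₂_comp {C : LexProfCat.{v}} {D : ParFL.{v}} {S T U : C ⟶ gammaObj D}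
    (a : S ⟶ T) (b : T ⟶ U) : transpose₂ (a ≫ b) = transpose₂ a ≫ transpose₂ b :=
  Functor.whiskerRight_comp (intMap₂ a) (intMap₂ b) (eps D)

theorem transpose₂_comp₆ {C : LexProfCat.{v}} {D : ParFL.{v}}
    {S₀ S₁ S₂ S₃ S₄ S₅ S₆ : C ⟶ gammaObj D}
    (a : S₀ ⟶ S₁) (b : S₁ ⟶ S₂) (c : S₂ ⟶ S₃) (d : S₃ ⟶ S₄) (e : S₄ ⟶ S₅) (f : S₅ ⟶ S₆)
    (x : IntObj C) :
    (transpose₂ (a ≫ b ≫ c ≫ d ≫ e ≫ f)).app x = (transpose₂ a).app x ≫ (transpose₂ b).app x ≫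
      (transpose₂ c).app x ≫ (transpose₂ d).app x ≫ (transpose₂ e).app x ≫
        (transpose₂ f).app x := by
  have h {S T U : C ⟶ gammaObj D} (a : S ⟶ T) (b : T ⟶ U) :
      (transpose₂ (a ≫ b)).app x = (transpose₂ a).app x ≫ (transpose₂ b).app x :=
    congr_app (transpose₂_comp a b) x
  rw [h, h, h, h, h]

theorem transpose₂_id {C : LexProfCat.{v}} {D : ParFL.{v}} (S : C ⟶ gammaObj D) :
    transpose₂ (S := S) (T := S) (𝟙 S) = 𝟙 (transpose S) :=
  Functor.whiskerRight_id (G := (intFunctor S)) (F := eps D)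

theorem integral_mapComp {C D E : LexProfCat.{v}} (F : C ⟶ D) (G : D ⟶ E) :
    (Integral.{v}.toPseudofunctor.mapComp F G).hom = 𝟙 _ := rfl

theorem gammaAbs_mapComp {C D E : ParFL.{v}} (F : C ⟶ D) (G : D ⟶ E) :
    (gammaAbs.{v}.mapComp F G).hom.hom = 𝟙 _ := rfl

theorem intAbs_mapComp {C D E : AbsTensored.{v}} (F : C ⟶ D) (G : D ⟶ E) :
    (intAbs.{v}.mapComp F G).hom = 𝟙 _ := by
  refine Eq.trans (b := Integral.map₂ (𝟙 (F.hom ≫ G.hom)) ≫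
    (Integral.{v}.toPseudofunctor.mapComp F.hom G.hom).hom) rfl ?_
  rw [integral_mapComp]
  exact (Category.comp_id _).trans (Integral.map₂_id _)

theorem intAbs_comp_gammaAbs_mapComp {C D E : AbsTensored.{v}} (F : C ⟶ D) (G : D ⟶ E) :
    ((intAbs.{v}.comp gammaAbs.{v}).mapComp F G).hom.hom = 𝟙 _ := by
  refine Eq.trans (b := Gamma.map₂ (intAbs.{v}.mapComp F G).hom ≫
    (gammaAbs.{v}.mapComp (intMap F.hom) (intMap G.hom)).hom.hom) rfl ?_
  rw [gammaAbs_mapComp]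
  refine (Category.comp_id _).trans ?_
  rw [intAbs_mapComp]
  exact Gamma.map₂_id _

/-- The unit as a pseudonatural transformation. -/
noncomputable def etaTrans : Pseudofunctor.id AbsTensored.{v} ⟶ intAbs.{v}.comp gammaAbs where
  app C := InducedBicategory.mkHom (eta C.1)
  naturality {C D} F := InducedBicategory.isoMk (etaIso F.hom)
  naturality_naturality {C D F G} τ := by
    apply InducedBicategory.hom₂_ext
    apply transpose₂_injective (C := C.1) (D := intObj D.1)
    have h₁ := transpose₂_etaIso F.hom
    have h₂ := transpose₂_etaIso G.hom
    have h₃ := transpose₂_eta_whiskerLeft (C := C.1) (D := intObj D.1) (F := intMap F.hom)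
      (G := intMap G.hom) (intMap₂ τ.hom)
    exact (congrArg (intMap₂ τ.hom ≫ ·) h₂).trans ((Category.comp_id _).trans
      ((Category.id_comp _).symm.trans ((congrArg (· ≫ intMap₂ τ.hom) h₁.symm).trans
        (congrArg (_ ≫ ·) h₃.symm))))
  naturality_id C := by
    apply InducedBicategory.hom₂_ext
    apply transpose₂_injective (C := C.1) (D := intObj C.1)
    apply NatTrans.ext
    funext (x : IntObj C.1)
    have h := congr_app (transpose₂_etaIso (𝟙 C.1)) x
    refine (congrArg (· ≫ _) h).trans ?_
    change 𝟙 x ≫ ((𝟙 x ≫ 𝟙 x) ≫ 𝟙 x) ≫ 𝟙 x = 𝟙 x ≫ 𝟙 x ≫ 𝟙 x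
    simp only [Category.comp_id]
  naturality_comp {C D E} F G := by
    apply InducedBicategory.hom₂_ext
    apply transpose₂_injective (C := C.1) (D := intObj E.1)
    apply NatTrans.ext
    funext (x : IntObj C.1)
    let y : IntObj E.1 := (intFunctor G.hom).obj ((intFunctor F.hom).obj x)
    let T {S T : C.1 ⟶ gammaObj (intObj E.1)} (α : S ⟶ T) :=
      NatTrans.app (transpose₂ (C := C.1) (D := intObj E.1) α) x
    let a : y ⟶ y := T (𝟙 (F.hom ≫ G.hom) ▷ eta E.1)
    let b : y ⟶ y := T (α_ F.hom G.hom (eta E.1)).hom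
    let c : y ⟶ y := T (F.hom ◁ (etaIso G.hom).hom)
    let d : y ⟶ y := T (α_ F.hom (eta D.1) (Gamma.map (Integral.map G.hom))).inv
    let e : y ⟶ y := T ((etaIso F.hom).hom ▷ Gamma.map (Integral.map G.hom))
    let f : y ⟶ y := T
      (α_ (eta C.1) (Gamma.map (Integral.map F.hom)) (Gamma.map (Integral.map G.hom))).hom
    have ha : a = 𝟙 y := rfl
    have hb : b = 𝟙 y := rfl
    have hc : c = 𝟙 y := congr_app (transpose₂_etaIso G.hom) ((intFunctor F.hom).obj x)
    have hd : d = 𝟙 y := congr_app (transpose₂_id (D := intObj E.1) _) x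
    have he : e = 𝟙 y := (congrArg (intFunctor G.hom).map
      (congr_app (transpose₂_etaIso F.hom) x)).trans ((intFunctor G.hom).map_id _)
    have hf : f = 𝟙 y := congr_app (transpose₂_id (D := intObj E.1) _) x
    have h₁ := congr_app (transpose₂_etaIso (F.hom ≫ G.hom)) x
    have h₂ : (InducedBicategory.mkHom (eta C.1) ◁ ((intAbs.comp gammaAbs).mapComp F G).hom).hom =
        𝟙 _ :=
      (congrArg (eta C.1 ◁ ·) (intAbs_comp_gammaAbs_mapComp F G)).trans
        (Bicategory.whiskerLeft_id _ _)
    have h₃ := congrArg (fun t => (transpose₂ (C := C.1) (D := intObj E.1) t).app x) h₂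
    refine (congrArg (· ≫ _) h₁).trans ?_
    refine (congrArg (_ ≫ ·) h₃).trans ?_
    refine (congrArg (_ ≫ ·) (congr_app (transpose₂_id _) x)).trans ?_
    refine (Category.id_comp (X := y) (Y := y) (𝟙 y)).trans ?_
    have h : 𝟙 y = a ≫ b ≫ c ≫ d ≫ e ≫ f := by
      rw [ha, hb, hc, hd, he, hf]
      simp only [Category.comp_id]
    exact h.trans (transpose₂_comp₆ (D := intObj E.1) _ _ _ _ _ _ x).symm

theorem gammaAbs_isBiequivalence : gammaAbs.{v}.IsBiequivalence := by
  refine ⟨intAbs, ?_, ?_⟩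
  · exact Pseudofunctor.StrongTrans.nonempty_equivalence epsTrans
      (fun D => (epsEquivalence D).inv) (fun D => (epsEquivalence D).unit)
      (fun D => (epsEquivalence D).counit)
  · obtain ⟨e⟩ := Pseudofunctor.StrongTrans.nonempty_equivalence etaTrans
      (fun C => InducedBicategory.mkHom (etaSplitEquivalence C.2).equivalence.inv)
      (fun C => InducedBicategory.isoMk (etaSplitEquivalence C.2).equivalence.unit)
      (fun C => InducedBicategory.isoMk (etaSplitEquivalence C.2).equivalence.counit)
    exact ⟨e.symm⟩

/-! ## The free completion under absolute tensors -/

theorem precomp_eta_isEquivalence (C D : LexProfCat.{v}) (hD : D.IsAbsoluteTensored) :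
    (precomp D (eta C)).IsEquivalence := by
  obtain ⟨D', ⟨e⟩⟩ := (essImage_gamma D).2 hD
  have h₁ := gamma_mapFunctor_isEquivalence (Integral.obj C) D'
  have h₂ := eta_comp_isEquivalence C D'
  have h₃ : (precomp (Gamma.obj D') (eta C)).IsEquivalence :=
    Functor.isEquivalence_of_comp_left (Gamma.mapFunctor (Integral.obj C) D') _
  have h₄ := fun X => postcomp_isEquivalence X e.unit e.counit
  have h₅ := h₄ C
  have h₆ := h₄ (Gamma.obj (Integral.obj C))
  have i : precomp (Gamma.obj D') (eta C) ⋙ postcomp C e.hom ≅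
      postcomp (Gamma.obj (Integral.obj C)) e.hom ⋙ precomp D (eta C) :=
    associatorNatIsoMiddle (eta C) e.hom
  have h₇ := Functor.isEquivalence_of_iso i
  exact Functor.isEquivalence_of_comp_left (postcomp (Gamma.obj (Integral.obj C)) e.hom) _

end ParFL

/-- The 2-functor `Γ` is an equivalence on hom-categories; its biessential image comprises the
absolute-tensored `LexProf`-categories; hence it is a biequivalence onto the full and locally full
sub-2-category on these; `∫` is left 2-adjoint to `Γ` with unit `η`; and `η : C ⟶ Γ(∫ C)` is the
free completion of `C` under absolute tensors. -/
theorem mainTheorem2 :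
    -- `Γ` is an equivalence on hom-categories
    (∀ C D : ParFL.{v}, (ParFL.Gamma.mapFunctor C D).IsEquivalence) ∧
    -- the biessential image of `Γ`
    (∀ C : LexProfCat.{v},
      (∃ D : ParFL.{v}, Nonempty (ParFL.Gamma.obj D ≌ C)) ↔ C.IsAbsoluteTensored) ∧
    -- the biequivalence
    (∃ h : ∀ D : ParFL.{v}, (ParFL.Gamma.obj D).IsAbsoluteTensored,
      (ParFL.Gamma.{v}.toPseudofunctor.liftFullSub
        (fun C : LexProfCat.{v} => C.IsAbsoluteTensored) h).IsBiequivalence) ∧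
    -- `η` is 2-natural
    (∀ (C D : LexProfCat.{v}) (F : C ⟶ D),
      ParFL.eta C ≫ ParFL.Gamma.map (ParFL.Integral.map F) = F ≫ ParFL.eta D) ∧
    (∀ (C D : LexProfCat.{v}) (F G : C ⟶ D) (α : F ⟶ G),
      HEq (ParFL.eta C ◁ ParFL.Gamma.map₂ (ParFL.Integral.map₂ α)) (α ▷ ParFL.eta D)) ∧
    -- `η` exhibits `∫` as left 2-adjoint to `Γ`
    (∀ (C : LexProfCat.{v}) (D : ParFL.{v}),
      (ParFL.Gamma.mapFunctor (ParFL.Integral.obj C) D ⋙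
        precomp (ParFL.Gamma.obj D) (ParFL.eta C)).IsEquivalence ∧
      Function.Bijective fun F : ParFL.Integral.obj C ⟶ D => ParFL.eta C ≫ ParFL.Gamma.map F) ∧
    -- `η` is the free completion under absolute tensors
    (∀ C : LexProfCat.{v}, (ParFL.Gamma.obj (ParFL.Integral.obj C)).IsAbsoluteTensored ∧
      ∀ D : LexProfCat.{v}, D.IsAbsoluteTensored →
        (precomp D (ParFL.eta C)).IsEquivalence) := by
  exact ⟨ParFL.gamma_mapFunctor_isEquivalence, ParFL.essImage_gamma,
    ⟨ParFL.gamma_isAbsoluteTensored, ParFL.gammaAbs_isBiequivalence⟩,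
    fun C D F => ParFL.eta_naturality F, fun C D F G α => ParFL.eta_naturality₂ α,
    fun C D => ⟨ParFL.eta_comp_isEquivalence C D, ParFL.eta_comp_bijective C D⟩,
    fun C => ⟨ParFL.gamma_isAbsoluteTensored _, ParFL.precomp_eta_isEquivalence C⟩⟩
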